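/- For an integer $n\ge 2$ and $x\in[-1+\tfrac2n,1]$ put \[ \Phi_n(x)=-1-\frac{4}{n^2}+\frac{3}{n}+\frac{3x}{n}-\frac{n-2}{\sqrt2\,n^2\sqrt{n-1}}\,(n-2+nx)^{3/2}, \] and define $\Phi:[-1,1]\to[-1,1]$ by $\Phi(-1)=-1$ and $\Phi(x)=\Phi_n(x)$ if $x\in\big[\tfrac{2-n}{n},\tfrac{2-(n-1)}{n-1}\big]$ for some $n\ge2$ (these intervals cover $(-1,1]$, and the formulas agree at common endpoints). Let $X,Y$ be real random variables on a common probability space whose distribution functions $F,G$ are continuous. Let $\rho(X,Y)$ (Spearman's $\rho$) be the Pearson correlation coefficient of $F(X)$ and $G(Y)$, and let \[ \tau(X,Y)=\mathbb P\big((X_1-X_2)(Y_1-Y_2)>0\big)-\mathbb P\big((X_1-X_2)(Y_1-Y_2)<0\big) \] (Kendall's $\tau$), where $(X_1,Y_1)$ and $(X_2,Y_2)$ are independent and distributed as $(X,Y)$. If $\tau(X,Y)=\tau_0$, then \[ \rho(X,Y)\in[\Phi(\tau_0),\,-\Phi(-\tau_0)]. \] These bounds are sharp: for every $\tau_0\in[-1,1]$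 there are random variables $X,Y$ with continuous distribution functions such that $\tau(X,Y)=\tau_0$ and $\rho(X,Y)=\Phi(\tau_0)$, and there are such $X,Y$ with $\tau(X,Y)=\tau_0$ and $\rho(X,Y)=-\Phi(-\tau_0)$. -/

import Mathlib

open MeasureTheory ProbabilityTheory

noncomputable section

/-- `X` is a continuous random variable on the probability space `(Ω, P)`: it is measurable and
its distribution function is continuous. -/
def IsContinuousRV {Ω : Type*} [MeasurableSpace Ω] (P : Measure Ω) (X : Ω → ℝ) : Prop :=
  Measurable X ∧ Continuous (cdf (P.map X))

/-- The Pearson correlation coefficient of `U` and `V`. -/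
def pearsonCorr {Ω : Type*} [MeasurableSpace Ω] (P : Measure Ω) (U V : Ω → ℝ) : ℝ :=
  covariance U V P / (√(variance U P) * √(variance V P))

/-- Spearman's `ρ`: the Pearson correlation coefficient of `F ∘ X` and `G ∘ Y`, where `F` and `G`
are the distribution functions of `X` and `Y`. -/
def spearmanRho {Ω : Type*} [MeasurableSpace Ω] (P : Measure Ω) (X Y : Ω → ℝ) : ℝ :=
  pearsonCorr P (fun ω => cdf (P.map X) (X ω)) (fun ω => cdf (P.map Y) (Y ω))

/-- Kendall's `τ`: the probability of concordance minus the probability of discordance of two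
independent copies of `(X, Y)`. On the product space `(Ω × Ω, P ⊗ P)` the pairs
`(X p.1, Y p.1)` and `(X p.2, Y p.2)` are such copies. -/
def kendallTau {Ω : Type*} [MeasurableSpace Ω] (P : Measure Ω) (X Y : Ω → ℝ) : ℝ :=
  (P.prod P).real {p | (X p.1 - X p.2) * (Y p.1 - Y p.2) > 0} -
    (P.prod P).real {p | (X p.1 - X p.2) * (Y p.1 - Y p.2) < 0}

/-- The functions `Φ_n`, used for `n ≥ 2` and `x ≥ -1 + 2 / n`. -/
def PhiAux (n : ℕ) (x : ℝ) : ℝ :=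
  -1 - 4 / (n : ℝ) ^ 2 + 3 / (n : ℝ) + 3 * x / (n : ℝ) -
    ((n : ℝ) - 2) / (√2 * (n : ℝ) ^ 2 * √((n : ℝ) - 1)) *
      ((n : ℝ) - 2 + (n : ℝ) * x) ^ (3 / 2 : ℝ)

/-- `x` lies in the `n`-th interval `[(2 - n) / n, (2 - (n - 1)) / (n - 1)]`, where `n ≥ 2`. -/
def PhiPiece (n : ℕ) (x : ℝ) : Prop :=
  2 ≤ n ∧ x ∈ Set.Icc ((2 - (n : ℝ)) / n) ((2 - ((n : ℝ) - 1)) / ((n : ℝ) - 1))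

open Classical in
/-- The function `Φ` on `[-1, 1]`: it equals `Φ_n` on the `n`-th interval, and `Φ (-1) = -1`.
The intervals cover `(-1, 1]`; neighbouring ones share an endpoint, at which the two formulas
agree, so the choice of the smallest admissible `n` is immaterial. -/
def Phi (x : ℝ) : ℝ :=
  if h : ∃ n : ℕ, PhiPiece n x then PhiAux (Nat.find h) x else -1

end

/-! For continuous margins, τ = 2p − 1 and ρ = 2t − 1, where p is the probability that two
independent points are concordant and t the probability that three independent points form at least
two concordant pairs (`kendallTau_eq`, `spearmanRho_eq`). The lower bound is therefore a question
about graphs: given the edge density p, how small can the density t of triples spanning at least two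
edges be? The answer `cubeMin n p` holds for every weighted graph with loops, not only for
concordance graphs. It is attained by a disjoint union of cliques, n − 1 of weight r = 1/n + z and
one of weight q = 1/n − (n − 1)z, with z determined by p; then p = ∑ rᵢ² and t = ∑ rᵢ³.

For a fixed finite graph, minimise t − `cubeMin n p` over the simplex of weights and suppose that
the minimum is negative (`cubeMin_le_of_minimizer`). Moving weight between two vertices gives first
and second order conditions (`optimality`). The first order condition confines every degree to the
open interval (q, r). The second order condition makes adjacent vertices twins, so the graph is a
union of cliques on the support, and forbids two small cliques of the same size. The sizes then have
to be the extremal ones, and a clique of weight r contradicts the degree bound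
(`false_of_clique_sizes`).

The bound passes to random variables by cutting the plane into finitely many cells and taking limits
(`cubeMin_le_concTripleProb`). The upper bound follows by replacing Y by −Y, which negates τ and ρ.
For sharpness, the extremal cliques are realised as blocks that are comonotone inside and discordant
with each other (`exists_of_stdSimplex`). -/

/-- The smallest value of `∑ rᵢ ^ 3` subject to `∑ rᵢ = 1` and `∑ rᵢ ^ 2 = p`,
for `p ∈ [1 / n, 1 / (n - 1)]`. -/
noncomputable def cubeMin (n p : ℝ) : ℝ :=
  1 / n ^ 2 + 3 / n * (p - 1 / n) - n * (n - 1) * (n - 2) * √((p - 1 / n) / (n * (n - 1))) ^ 3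

/-- The majority function of three `0`-`1` values. -/
def majority (u v w : ℝ) : ℝ := u * v + v * w + u * w - 2 * (u * v * w)

/-! ### Weighted graphs with loops, and the effect of moving weight between vertices. -/

section Finite

variable {ι : Type*} [Fintype ι]

/-- The mean of `f` with respect to the weights `x`. -/
def wsum (x f : ι → ℝ) : ℝ := ∑ i, x i * f i

/-- The weighted degree of `i` in the graph with adjacency matrix `a`. -/
def wdeg (a : ι → ι → ℝ) (x : ι → ℝ) (i : ι) : ℝ := wsum x fun j => a i j

/-- The weighted number of pairs containing `i` that, with `i`, span at least two edges. -/
def wcherry (a : ι → ι → ℝ) (x : ι → ℝ) (i : ι) : ℝ :=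
  wsum x fun j => wsum x fun k => majority (a i j) (a j k) (a i k)

/-- The weighted edge density. -/
def pairMass (a : ι → ι → ℝ) (x : ι → ℝ) : ℝ := wsum x (wdeg a x)

/-- The weighted density of triples spanning at least two edges. -/
def tripleMass (a : ι → ι → ℝ) (x : ι → ℝ) : ℝ := wsum x (wcherry a x)

/-- `a` is the adjacency matrix of a graph with a loop at every vertex. -/
structure IsReflGraph (a : ι → ι → ℝ) : Prop where
  symm : ∀ i j, a i j = a j i
  refl : ∀ i, a i i = 1
  zero_or_one : ∀ i j, a i j = 0 ∨ a i j = 1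

lemma wsum_add (x f g : ι → ℝ) : wsum x (fun i => f i + g i) = wsum x f + wsum x g := by
  simp [wsum, mul_add, Finset.sum_add_distrib]

lemma wsum_sub (x f g : ι → ℝ) : wsum x (fun i => f i - g i) = wsum x f - wsum x g := by
  simp [wsum, mul_sub, Finset.sum_sub_distrib]

lemma wsum_const_mul (x f : ι → ℝ) (c : ℝ) : wsum x (fun i => c * f i) = c * wsum x f := by
  simp only [wsum, Finset.mul_sum]
  exact Finset.sum_congr rfl fun i _ => by ring

lemma wsum_mul_const (x f : ι → ℝ) (c : ℝ) : wsum x (fun i => f i * c) = wsum x f * c := by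
  simp only [wsum, Finset.sum_mul]
  exact Finset.sum_congr rfl fun i _ => by ring

lemma wsum_const {x : ι → ℝ} (hx : x ∈ stdSimplex ℝ ι) (c : ℝ) : wsum x (fun _ => c) = c := by
  simp [wsum, ← Finset.sum_mul, hx.2]

lemma wsum_congr {x f g : ι → ℝ} (hx : x ∈ stdSimplex ℝ ι) (h : ∀ i, 0 < x i → f i = g i) :
    wsum x f = wsum x g := by
  refine Finset.sum_congr rfl fun i _ => ?_
  rcases (hx.1 i).eq_or_lt with h0 | h0
  · simp [← h0]
  · rw [h i h0]

lemma wsum_mono {x f g : ι → ℝ} (hx : x ∈ stdSimplex ℝ ι) (h : ∀ i, 0 < x i → f i ≤ g i) :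
    wsum x f ≤ wsum x g := by
  refine Finset.sum_le_sum fun i _ => ?_
  rcases (hx.1 i).eq_or_lt with h0 | h0
  · simp [← h0]
  · exact mul_le_mul_of_nonneg_left (h i h0) h0.le

lemma continuous_wsum {E : Type*} [TopologicalSpace E] {y : E → ι → ℝ} {f : E → ι → ℝ}
    (hy : Continuous y) (hf : ∀ i, Continuous fun e => f e i) :
    Continuous fun e => wsum (y e) (f e) :=
  continuous_finsetSum _ fun i _ => ((continuous_apply i).comp hy).mul (hf i)

lemma continuous_pairMass (a : ι → ι → ℝ) : Continuous (pairMass a) :=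
  continuous_wsum continuous_id fun _ => continuous_wsum continuous_id fun _ => continuous_const

lemma continuous_tripleMass (a : ι → ι → ℝ) : Continuous (tripleMass a) :=
  continuous_wsum continuous_id fun _ => continuous_wsum continuous_id fun _ =>
    continuous_wsum continuous_id fun _ => continuous_const

lemma majority_nonneg {u v w : ℝ} (hu : u = 0 ∨ u = 1) (hv : v = 0 ∨ v = 1)
    (hw : w = 0 ∨ w = 1) : 0 ≤ majority u v w ∧ u * w ≤ majority u v w := by
  rcases hu with rfl | rfl <;> rcases hv with rfl | rfl <;> rcases hw with rfl | rfl <;>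
    norm_num [majority]

/-- Two neighbours of `i` already give two edges at `i`. Equality holds in unions of cliques. -/
lemma sq_wdeg_le_wcherry {a : ι → ι → ℝ} (ha : IsReflGraph a) {x : ι → ℝ}
    (hx : x ∈ stdSimplex ℝ ι) (i : ι) : wdeg a x i ^ 2 ≤ wcherry a x i := by
  have h : wdeg a x i ^ 2 = wsum x fun j => wsum x fun k => a i j * a i k := by
    simp only [wsum_const_mul, wsum_mul_const, wdeg, sq]
  rw [h]
  exact wsum_mono hx fun j _ => wsum_mono hx fun k _ =>
    (majority_nonneg (ha.zero_or_one _ _) (ha.zero_or_one _ _) (ha.zero_or_one _ _)).2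

lemma sq_pairMass_le_tripleMass {a : ι → ι → ℝ} (ha : IsReflGraph a) {x : ι → ℝ}
    (hx : x ∈ stdSimplex ℝ ι) : pairMass a x ^ 2 ≤ tripleMass a x := by
  -- Jensen's inequality for the square, through the tangent line at the mean degree.
  have h1 : wsum x (fun i => 2 * pairMass a x * wdeg a x i - pairMass a x ^ 2) ≤
      tripleMass a x := wsum_mono hx fun i _ => by
    nlinarith [sq_wdeg_le_wcherry ha hx i, sq_nonneg (wdeg a x i - pairMass a x)]
  rw [wsum_sub, wsum_const_mul, wsum_const hx] at h1
  change 2 * pairMass a x * pairMass a x - _ ≤ _ at h1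
  linarith

/-- Move mass `ε` from `j` to `i`. -/
def shiftMass [DecidableEq ι] (x : ι → ℝ) (i j : ι) (ε : ℝ) : ι → ℝ :=
  fun k => x k + ε * ((Pi.single i 1 : ι → ℝ) k - (Pi.single j 1 : ι → ℝ) k)

lemma wsum_shiftMass [DecidableEq ι] (x : ι → ℝ) (i j : ι) (ε : ℝ) (f : ι → ℝ) :
    wsum (shiftMass x i j ε) f = wsum x f + ε * (f i - f j) := by
  simp only [wsum, shiftMass, add_mul, Finset.sum_add_distrib, mul_assoc, ← Finset.mul_sum,
    sub_mul, Finset.sum_sub_distrib]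
  simp [Pi.single_apply]

lemma shiftMass_mem [DecidableEq ι] {x : ι → ℝ} (hx : x ∈ stdSimplex ℝ ι) {i j : ι} (hij : i ≠ j)
    {ε : ℝ} (hi : 0 ≤ x i + ε) (hj : 0 ≤ x j - ε) : shiftMass x i j ε ∈ stdSimplex ℝ ι := by
  refine ⟨fun k => ?_, ?_⟩
  · have := hx.1 k
    by_cases h1 : k = i
    · subst h1; simpa [shiftMass, Pi.single_apply, hij] using hi
    · by_cases h2 : k = j
      · subst h2; simpa [shiftMass, Pi.single_apply, h1, sub_eq_add_neg] using hj
      · simpa [shiftMass, Pi.single_apply, h1, h2] using this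
  · have := wsum_shiftMass x i j ε fun _ => 1
    simpa [wsum, hx.2] using this

lemma pairMass_shiftMass [DecidableEq ι] {a : ι → ι → ℝ} (ha : IsReflGraph a) (x : ι → ℝ)
    (i j : ι) (ε : ℝ) : pairMass a (shiftMass x i j ε) =
      pairMass a x + 2 * ε * (wdeg a x i - wdeg a x j) + 2 * ε ^ 2 * (1 - a i j) := by
  have e : ∀ u, (wsum x fun k => a k u) = wdeg a x u := by
    intro u
    unfold wdeg
    congr 1; ext k; exact ha.symm _ _
  have e' : ∀ u, (wsum x fun k => a u k) = wdeg a x u := fun u => rfl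
  have t : ∀ y : ι → ℝ, pairMass a y = wsum y fun k => wsum y fun l => a k l := fun y => rfl
  rw [t, t]
  simp only [wsum_shiftMass, wsum_add, wsum_sub, wsum_const_mul, e, e']
  rw [ha.refl, ha.refl, ha.symm j i]
  ring

/-- The weighted number of vertices at which the neighbourhoods of `i` and `j` differ. -/
def wdiff (a : ι → ι → ℝ) (x : ι → ℝ) (i j : ι) : ℝ := wsum x fun k => (a i k - a j k) ^ 2

/-- The majority kernel is symmetric in its three vertices, so this is the expansion of a cubic
form. The ε³ coefficient 1 − 3a + 3a − 1 vanishes because of the loops. In the ε² coefficient the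
majority over `i`, `j`, `k` is the "or" or the "and" of `a i k` and `a j k`, according as `i` and
`j` are adjacent or not, hence the sign `1 - 2 * a i j`. -/
lemma tripleMass_shiftMass [DecidableEq ι] {a : ι → ι → ℝ} (ha : IsReflGraph a) (x : ι → ℝ)
    (i j : ι) (ε : ℝ) : tripleMass a (shiftMass x i j ε) =
      tripleMass a x + 3 * ε * (wcherry a x i - wcherry a x j) +
        3 * ε ^ 2 * ((1 - 2 * a i j) * wdiff a x i j) := by
  have hc1 : ∀ i j k, majority (a i j) (a j k) (a i k) = majority (a j i) (a i k) (a j k) := by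
    intro i j k; rw [ha.symm j i]; unfold majority; ring
  have hc2 : ∀ i j k, majority (a i j) (a j k) (a i k) = majority (a i k) (a k j) (a i j) := by
    intro i j k; rw [ha.symm k j]; unfold majority; ring
  set c : ι → ι → ι → ℝ := fun i j k => majority (a i j) (a j k) (a i k) with hc
  have h1 : ∀ i j k, c i j k = c j i k := hc1
  have h2 : ∀ i j k, c i j k = c i k j := hc2
  have hiik : ∀ i k, c i i k = a i k := by
    intro i k
    simp only [hc, ha.refl]
    rcases ha.zero_or_one i k with h | h <;> rw [h] <;> norm_num [majority]
  have hM : (1 - 2 * a i j) * wdiff a x i j =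
      wsum x (fun k => c i i k) + wsum x (fun k => c j j k) - 2 * wsum x (fun k => c i j k) := by
    rw [wdiff, ← wsum_const_mul, ← wsum_const_mul, ← wsum_add, ← wsum_sub]
    congr 1
    ext k
    rw [hiik, hiik]
    rcases ha.zero_or_one i j with h | h <;> rcases ha.zero_or_one i k with h' | h' <;>
      rcases ha.zero_or_one j k with h'' | h'' <;> simp only [hc, h, h', h''] <;>
      norm_num [majority]
  have e2 : ∀ u, (wsum x fun k => wsum x fun l => c k u l) = wcherry a x u := by
    intro u
    unfold wcherry
    congr 1; ext k; congr 1; ext l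
    exact h1 _ _ _
  have e3 : ∀ u, (wsum x fun k => wsum x fun l => c u k l) = wcherry a x u := fun u => rfl
  have f1 : ∀ u v, (wsum x fun k => c k u v) = wsum x fun k => c u v k := by
    intro u v; congr 1; ext k; rw [h1, h2]
  have f2 : ∀ u v, (wsum x fun k => c u k v) = wsum x fun k => c u v k := by
    intro u v; congr 1; ext k; rw [h2]
  have f3 : (wsum x fun k => c j i k) = wsum x fun k => c i j k := by
    congr 1; ext k; rw [h1]
  have t : ∀ y : ι → ℝ, tripleMass a y = wsum y fun k => wsum y fun l => wsum y fun m => c k l m :=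
    fun y => rfl
  rw [hM, t, t]
  simp only [wsum_shiftMass, wsum_add, wsum_sub, wsum_const_mul, e2, e3, f1, f2, f3]
  have g1 : c i i j = a i j := hiik _ _
  have g2 : c i j i = a i j := by rw [h2]; exact hiik _ _
  have g3 : c j i i = a i j := by rw [h1]; exact g2
  have g4 : c j j i = a i j := by rw [hiik, ha.symm]
  have g5 : c j i j = a i j := by rw [h2]; exact g4
  have g6 : c i j j = a i j := by rw [h1]; exact g5
  have g7 : c i i i = 1 := by rw [hiik, ha.refl]
  have g8 : c j j j = 1 := by rw [hiik, ha.refl]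
  rw [g1, g2, g3, g4, g5, g6, g7, g8]
  ring

end Finite

/-! ### One-variable calculus for the optimality conditions. -/

/-- A quadratic minorant of `cubeMin` touching it at `p`. It makes perturbations polynomial in the
step size, so that no square root has to be differentiated. In terms of w and z the error is a
nonnegative multiple of (w − z)² w² / (2z). -/
lemma cubeMin_tangent {n p p' z : ℝ} (hn : 2 ≤ n) (hz : 0 < z)
    (hp : p = 1 / n + n * (n - 1) * z ^ 2) (hp' : 1 / n ≤ p') :
    cubeMin n p + 3 / 2 * (2 / n - (n - 2) * z) * (p' - p) -
      (n - 2) / (2 * z * n * (n - 1)) * (p' - p) ^ 2 ≤ cubeMin n p' := by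
  have hn0 : 0 < n := by linarith
  have hn1 : 0 < n - 1 := by linarith
  have hn2 : 0 ≤ n - 2 := by linarith
  set w := √((p' - 1 / n) / (n * (n - 1))) with hw
  have hw0 : 0 ≤ w := Real.sqrt_nonneg _
  have hpw : p' = 1 / n + n * (n - 1) * w ^ 2 := by
    rw [hw, Real.sq_sqrt (div_nonneg (by linarith) (by positivity))]
    field_simp
    ring
  have hzp : √((p - 1 / n) / (n * (n - 1))) = z := by
    rw [hp, show (1 / n + n * (n - 1) * z ^ 2 - 1 / n) / (n * (n - 1)) = z ^ 2 by field_simp; ring]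
    exact Real.sqrt_sq hz.le
  unfold cubeMin
  rw [← hw, hzp]
  have key : w ^ 3 ≤ z ^ 3 + 3 / 2 * z * (w ^ 2 - z ^ 2) + (w ^ 2 - z ^ 2) ^ 2 / (2 * z) := by
    have : z ^ 3 + 3 / 2 * z * (w ^ 2 - z ^ 2) + (w ^ 2 - z ^ 2) ^ 2 / (2 * z) - w ^ 3 =
        (w - z) ^ 2 * w ^ 2 / (2 * z) := by
      field_simp; ring
    have h2 : 0 ≤ (w - z) ^ 2 * w ^ 2 / (2 * z) := by positivity
    linarith
  have hd : p' - p = n * (n - 1) * (w ^ 2 - z ^ 2) := by rw [hpw, hp]; ring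
  have e2 : (n - 2) / (2 * z * n * (n - 1)) * (p' - p) ^ 2 =
      n * (n - 1) * (n - 2) * ((w ^ 2 - z ^ 2) ^ 2 / (2 * z)) := by
    rw [hd]; field_simp
  have hmul := mul_le_mul_of_nonneg_left key (by positivity : 0 ≤ n * (n - 1) * (n - 2))
  have e3 : (n - 2) * z * (p' - p) = n * (n - 1) * (n - 2) * (z * (w ^ 2 - z ^ 2)) := by
    rw [hd]; ring
  rw [e2]
  have e4 : 3 / n * (p' - 1 / n) - 3 / n * (p - 1 / n) = 3 / 2 * (2 / n) * (p' - p) := by ring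
  nlinarith

lemma nonneg_of_forall_small {g : ℝ → ℝ} (hg : Continuous g) {η : ℝ} (hη : 0 < η)
    (h : ∀ ε, 0 < ε → ε < η → 0 ≤ g ε) : 0 ≤ g 0 := by
  have ht : Filter.Tendsto g (nhdsWithin 0 (Set.Ioi 0)) (nhds (g 0)) :=
    hg.continuousAt.continuousWithinAt
  refine ge_of_tendsto ht ?_
  filter_upwards [Ioo_mem_nhdsGT hη] with ε hε using h ε hε.1 hε.2

/-- Divide by ±ε, then by ε², and let ε tend to 0. -/
lemma quartic_coeff_of_nonneg {L Q R S η : ℝ} (hη : 0 < η)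
    (h : ∀ ε, |ε| < η → 0 ≤ L * ε + Q * ε ^ 2 + R * ε ^ 3 + S * ε ^ 4) : L = 0 ∧ 0 ≤ Q := by
  have h1 : 0 ≤ L := by
    have := nonneg_of_forall_small (g := fun ε => L + Q * ε + R * ε ^ 2 + S * ε ^ 3)
      (by fun_prop) hη fun ε h0 h1 => by
        have h2 := h ε (by rwa [abs_of_pos h0])
        refine nonneg_of_mul_nonneg_right (a := ε) ?_ h0
        linarith
    simpa using this
  have h2 : 0 ≤ -L := by
    have := nonneg_of_forall_small (g := fun ε => -L + Q * ε - R * ε ^ 2 + S * ε ^ 3)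
      (by fun_prop) hη fun ε h0 h1 => by
        have h2 := h (-ε) (by rwa [abs_neg, abs_of_pos h0])
        refine nonneg_of_mul_nonneg_right (a := ε) ?_ h0
        linarith
    simpa using this
  have hL : L = 0 := by linarith
  refine ⟨hL, ?_⟩
  have := nonneg_of_forall_small (g := fun ε => Q + R * ε + S * ε ^ 2)
    (by fun_prop) hη fun ε h0 h1 => by
      have h2 := h ε (by rwa [abs_of_pos h0])
      refine nonneg_of_mul_nonneg_right (a := ε ^ 2) ?_ (by positivity)
      rw [hL] at h2
      linarith
  simpa using this

/-! ### Structure of a minimiser, and the extremal inequality for finite graphs. -/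

section Finite

variable {ι : Type*} [Fintype ι]

/-- First and second order conditions at a minimum of `tripleMass - cubeMin (pairMass)`. -/
lemma optimality {a : ι → ι → ℝ} (ha : IsReflGraph a) {x : ι → ℝ}
    (hx : x ∈ stdSimplex ℝ ι) {n z : ℝ} (hn : 2 ≤ n) (hz : 0 < z)
    (hp : pairMass a x = 1 / n + n * (n - 1) * z ^ 2) (hp' : pairMass a x < 1 / (n - 1))
    (hmin : ∀ y ∈ stdSimplex ℝ ι, pairMass a y ∈ Set.Icc (1 / n) (1 / (n - 1)) →
      tripleMass a x - cubeMin n (pairMass a x) ≤ tripleMass a y - cubeMin n (pairMass a y))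
    {i j : ι} (hij : i ≠ j) (hi : 0 < x i) (hj : 0 < x j) :
    wcherry a x i - wcherry a x j = (2 / n - (n - 2) * z) * (wdeg a x i - wdeg a x j) ∧
    0 ≤ 3 * ((1 - 2 * a i j) * wdiff a x i j) - 3 * (2 / n - (n - 2) * z) * (1 - a i j) +
      4 * ((n - 2) / (2 * z * n * (n - 1))) * (wdeg a x i - wdeg a x j) ^ 2 := by
  classical
  have hn0 : 0 < n := by linarith
  have hn1 : 0 < n - 1 := by linarith
  set σ := 2 / n - (n - 2) * z
  set K := (n - 2) / (2 * z * n * (n - 1)) with hK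
  set Δ := wdeg a x i - wdeg a x j
  have hc : Continuous fun ε => pairMass a (shiftMass x i j ε) :=
    (continuous_pairMass a).comp (by unfold shiftMass; fun_prop)
  have h0 : pairMass a (shiftMass x i j 0) = pairMass a x := by
    rw [pairMass_shiftMass ha]; ring
  have hopen : ∀ᶠ ε in nhds (0 : ℝ),
      pairMass a (shiftMass x i j ε) ∈ Set.Ioo (1 / n) (1 / (n - 1)) := by
    refine hc.continuousAt.eventually_mem (isOpen_Ioo.mem_nhds ?_)
    rw [h0]
    refine ⟨?_, hp'⟩
    rw [hp]
    have : 0 < n * (n - 1) * z ^ 2 := by positivity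
    linarith
  obtain ⟨η, hη, hball⟩ := Metric.eventually_nhds_iff.1 hopen
  -- These are the coefficients of the change in triple mass minus the change in the quadratic
  -- minorant of `cubeMin`, for a transfer of weight ε from `j` to `i`.
  have := quartic_coeff_of_nonneg (L := 3 * (wcherry a x i - wcherry a x j) - 3 * σ * Δ)
    (Q := 3 * ((1 - 2 * a i j) * wdiff a x i j) - 3 * σ * (1 - a i j) + 4 * K * Δ ^ 2)
    (R := 8 * K * Δ * (1 - a i j)) (S := 4 * K * (1 - a i j) ^ 2)
    (lt_min hη (lt_min hi hj)) fun ε hε => by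
      obtain ⟨h1, h2⟩ := lt_min_iff.1 hε
      obtain ⟨h2, h3⟩ := lt_min_iff.1 h2
      have hm := hball (y := ε) (by simpa using h1)
      have hS := shiftMass_mem hx hij (ε := ε) (by linarith [neg_abs_le ε])
        (by linarith [le_abs_self ε])
      have hmin' := hmin _ hS ⟨hm.1.le, hm.2.le⟩
      have ht := cubeMin_tangent hn hz hp hm.1.le
      rw [← hK] at ht
      rw [tripleMass_shiftMass ha] at hmin'
      have hd : pairMass a (shiftMass x i j ε) - pairMass a x =
          2 * ε * Δ + 2 * ε ^ 2 * (1 - a i j) := by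
        rw [pairMass_shiftMass ha]; ring
      rw [hd] at ht
      linarith
  exact ⟨by linarith [this.1], this.2⟩

lemma wdeg_pos {a : ι → ι → ℝ} (ha : IsReflGraph a) {x : ι → ℝ} (hx : x ∈ stdSimplex ℝ ι)
    {i : ι} (hi : 0 < x i) : 0 < wdeg a x i := by
  refine Finset.sum_pos' (fun j _ => mul_nonneg (hx.1 j) ?_) ⟨i, Finset.mem_univ i, ?_⟩
  · rcases ha.zero_or_one i j with h | h <;> simp [h]
  · simpa [ha.refl i] using hi

/-- In a disjoint union of cliques, the sum of the reciprocals of the degrees is the number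
of cliques. -/
lemma exists_nat_wsum_inv_wdeg {a : ι → ι → ℝ} (ha : IsReflGraph a) {x : ι → ℝ}
    (hx : x ∈ stdSimplex ℝ ι) (hcl : ∀ i j, 0 < x i → 0 < x j → a i j = 1 →
      ∀ k, 0 < x k → a i k = a j k) : ∃ m : ℕ, wsum x (fun i => (wdeg a x i)⁻¹) = m := by
  classical
  set S : Finset ι := Finset.univ.filter fun i => 0 < x i with hS
  -- Neighbourhoods restricted to the support label the cliques. The vertices with a given label
  -- have total weight equal to their common degree, so each label contributes 1 to the sum.
  let g : ι → ι → ℝ := fun i k => if 0 < x k then a i k else 0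
  have hmem : ∀ {i}, i ∈ S ↔ 0 < x i := by simp [hS]
  have hsum : ∀ f : ι → ℝ, wsum x f = ∑ i ∈ S, x i * f i := by
    intro f
    refine (Finset.sum_subset (Finset.subset_univ S) fun i _ hi => ?_).symm
    have : x i = 0 := le_antisymm (not_lt.1 fun h => hi (hmem.2 h)) (hx.1 i)
    simp [this]
  refine ⟨(S.image g).card, ?_⟩
  rw [hsum, ← Finset.sum_fiberwise_of_maps_to (t := S.image g)
    (fun i hi => Finset.mem_image_of_mem g hi)]
  rw [Finset.sum_congr rfl (g := fun _ => (1 : ℝ)), Finset.sum_const, nsmul_one]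
  intro b hb
  obtain ⟨i, hi, rfl⟩ := Finset.mem_image.1 hb
  have hi' := hmem.1 hi
  have hg : ∀ j ∈ S, g j = g i ↔ a i j = 1 := by
    intro j hj
    have hj' := hmem.1 hj
    refine ⟨fun h => ?_, fun h => ?_⟩
    · have := congrFun h j
      simp only [g, hj', if_true, ha.refl] at this
      exact this.symm
    · ext k
      simp only [g]
      split_ifs with hk
      · exact (hcl i j hi' hj' h k hk).symm
      · rfl
  have hterm : ∀ j ∈ S.filter (fun j => g j = g i),
      x j * (wdeg a x j)⁻¹ = x j * (wdeg a x i)⁻¹ := by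
    intro j hj
    obtain ⟨hj, hgj⟩ := Finset.mem_filter.1 hj
    have : wdeg a x j = wdeg a x i := by
      refine wsum_congr hx fun k hk => ?_
      exact (hcl i j hi' (hmem.1 hj) ((hg j hj).1 hgj) k hk).symm
    rw [this]
  rw [Finset.sum_congr rfl hterm, ← Finset.sum_mul]
  have : ∑ j ∈ S.filter (fun j => g j = g i), x j = wdeg a x i := by
    rw [wdeg, hsum, Finset.sum_filter]
    refine Finset.sum_congr rfl fun j hj => ?_
    rcases ha.zero_or_one i j with h | h
    · rw [if_neg, h, mul_zero]
      rw [hg j hj, h]; norm_num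
    · rw [if_pos ((hg j hj).2 h), h, mul_one]
  rw [this, mul_inv_cancel₀ (wdeg_pos ha hx hi').ne']

lemma abs_wdeg_sub_le_wdiff {a : ι → ι → ℝ} (ha : IsReflGraph a) {x : ι → ℝ}
    (hx : x ∈ stdSimplex ℝ ι) (i j : ι) : |wdeg a x i - wdeg a x j| ≤ wdiff a x i j := by
  have key : ∀ k, a i k - a j k ≤ (a i k - a j k) ^ 2 ∧ a j k - a i k ≤ (a i k - a j k) ^ 2 := by
    intro k
    rcases ha.zero_or_one i k with h | h <;> rcases ha.zero_or_one j k with h' | h' <;>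
      rw [h, h'] <;> norm_num
  rw [abs_le']
  constructor
  · rw [wdeg, wdeg, ← wsum_sub]
    exact wsum_mono hx fun k _ => (key k).1
  · rw [neg_sub, wdeg, wdeg, ← wsum_sub]
    exact wsum_mono hx fun k _ => (key k).2

lemma adj_eq_of_wdiff_eq_zero {a : ι → ι → ℝ} {x : ι → ℝ} (hx : x ∈ stdSimplex ℝ ι) {i j : ι}
    (h : wdiff a x i j = 0) {k : ι} (hk : 0 < x k) : a i k = a j k := by
  have h1 := (Finset.sum_eq_zero_iff_of_nonneg
    (fun k _ => mul_nonneg (hx.1 k) (sq_nonneg (a i k - a j k)))).1 h k (Finset.mem_univ k)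
  have h2 : (a i k - a j k) ^ 2 = 0 := (mul_eq_zero.1 h1).resolve_left hk.ne'
  exact sub_eq_zero.1 (pow_eq_zero_iff (two_ne_zero)|>.1 h2)

lemma wcherry_eq_sq_of_cliques {a : ι → ι → ℝ} (ha : IsReflGraph a) {x : ι → ℝ}
    (hx : x ∈ stdSimplex ℝ ι) (hcl : ∀ i j, 0 < x i → 0 < x j → a i j = 1 →
      ∀ k, 0 < x k → a i k = a j k) {i : ι} (hi : 0 < x i) :
    wcherry a x i = wdeg a x i ^ 2 := by
  have h : wdeg a x i ^ 2 = wsum x fun j => wsum x fun k => a i j * a i k := by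
    simp only [wsum_const_mul, wsum_mul_const, wdeg, sq]
  rw [h]
  refine wsum_congr hx fun j hj => wsum_congr hx fun k hk => ?_
  rcases ha.zero_or_one i j with h1 | h1
  · rcases ha.zero_or_one j k with h2 | h2
    · simp [h1, h2, majority]
    · have := hcl j k hj hk h2 i hi
      rw [ha.symm k i, ha.symm j i, h1] at this
      simp [h1, ← this, majority]
  · have := hcl i j hi hj h1 k hk
    rw [← this, h1]
    rcases ha.zero_or_one i k with h2 | h2 <;> rw [h2] <;> norm_num [majority]

lemma cubeMin_left {n : ℝ} : cubeMin n (1 / n) = (1 / n) ^ 2 := by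
  simp [cubeMin]

lemma cubeMin_param {n z : ℝ} (hn : 2 ≤ n) (hz : 0 ≤ z) :
    cubeMin n (1 / n + n * (n - 1) * z ^ 2) =
      1 / n ^ 2 + 3 * (n - 1) * z ^ 2 - n * (n - 1) * (n - 2) * z ^ 3 := by
  have hn0 : 0 < n := by linarith
  have hn1 : 0 < n - 1 := by linarith
  unfold cubeMin
  rw [show (1 / n + n * (n - 1) * z ^ 2 - 1 / n) / (n * (n - 1)) = z ^ 2 by field_simp; ring,
    Real.sqrt_sq hz]
  field_simp
  ring

lemma pair_param {n p : ℝ} (hn : 2 ≤ n) (hp : p ∈ Set.Icc (1 / n) (1 / (n - 1))) :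
    ∃ z, 0 ≤ z ∧ z ≤ 1 / (n * (n - 1)) ∧ p = 1 / n + n * (n - 1) * z ^ 2 := by
  have hn0 : 0 < n := by linarith
  have hn1 : 0 < n - 1 := by linarith
  refine ⟨√((p - 1 / n) / (n * (n - 1))), Real.sqrt_nonneg _, ?_, ?_⟩
  · rw [Real.sqrt_le_left (by positivity), div_pow, div_le_div_iff₀ (by positivity) (by positivity)]
    have h1 : p - 1 / n ≤ 1 / (n * (n - 1)) := by
      have : 1 / (n - 1) - 1 / n = 1 / (n * (n - 1)) := by field_simp; ring
      linarith [hp.2]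
    have h2 : 0 < n * (n - 1) := by positivity
    rw [le_div_iff₀ h2] at h1
    nlinarith
  · rw [Real.sq_sqrt (div_nonneg (by linarith [hp.1]) (by positivity))]
    field_simp
    ring

lemma cubeMin_right {n : ℝ} (hn : 2 ≤ n) : cubeMin n (1 / (n - 1)) = (1 / (n - 1)) ^ 2 := by
  have hn0 : 0 < n := by linarith
  have hn1 : 0 < n - 1 := by linarith
  have h := cubeMin_param hn (z := 1 / (n * (n - 1))) (by positivity)
  rw [show 1 / n + n * (n - 1) * (1 / (n * (n - 1))) ^ 2 = 1 / (n - 1) by field_simp; ring] at h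
  rw [h]
  field_simp
  ring

/-- Here one clique has size α and m − 1 have the larger size β. Then p lies strictly between 1/m
and 1/(m − 1), which forces m = n, and n(n − 1)(β − 1/n)² = p − 1/n determines β. -/
lemma eq_of_clique_sizes {n m : ℕ} (hn : 2 ≤ n) {α β p z : ℝ} (hz : 0 < z)
    (hpz : p = 1 / (n : ℝ) + n * (n - 1) * z ^ 2) (hp1 : p < 1 / ((n : ℝ) - 1)) (hα : 0 < α)
    (hα1 : α < 1) (hαβ : α < β) (hm : (m - 1 : ℝ) * β = 1 - α) (hp : p = β + α * (α - β)) :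
    β = 1 / (n : ℝ) + z := by
  have hn' : (2 : ℝ) ≤ n := by exact_mod_cast hn
  have hn0 : (0 : ℝ) < n := by linarith
  have hn1 : (0 : ℝ) < (n : ℝ) - 1 := by linarith
  have hβ : 0 < β := hα.trans hαβ
  have hp0 : 1 / (n : ℝ) < p := by
    have : 0 < (n : ℝ) * (n - 1) * z ^ 2 := by positivity
    linarith
  have hm1 : (0 : ℝ) < (m : ℝ) - 1 := by
    by_contra! h
    nlinarith
  have hm0 : (0 : ℝ) < m := by linarith
  have hpm : p = (m - 1) * β ^ 2 + α ^ 2 := by rw [hp]; linear_combination (-β) * hm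
  have hmα : m * α < 1 := by nlinarith
  have hlow : 1 / (m : ℝ) < p := by
    rw [div_lt_iff₀ hm0]
    have : p * m - 1 = (m - 1) * (β - α) ^ 2 := by
      rw [hpm]; linear_combination ((m - 1) * β + α + 1) * hm
    have h2 : 0 < ((m : ℝ) - 1) * (β - α) ^ 2 := mul_pos hm1 (pow_pos (by linarith) 2)
    linarith
  have hupp : p < 1 / ((m : ℝ) - 1) := by
    rw [lt_div_iff₀ hm1]
    have : 1 - p * (m - 1) = α * (2 - m * α) := by
      rw [hpm]; linear_combination (-((m - 1) * β + 1 - α)) * hm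
    have h2 : 0 < α * (2 - m * α) := mul_pos hα (by linarith)
    linarith
  have hmn : m = n := by
    have h1 := hp0.trans hupp
    have h2 := hlow.trans hp1
    rw [one_div_lt_one_div hn0 hm1] at h1
    rw [one_div_lt_one_div hm0 hn1] at h2
    have h3 : m < n + 1 := by
      have : (m : ℝ) < n + 1 := by linarith
      exact_mod_cast this
    have h4 : n < m + 1 := by
      have : (n : ℝ) < m + 1 := by linarith
      exact_mod_cast this
    omega
  subst hmn
  have hα' : α = 1 - (m - 1) * β := by linarith
  have hy : (β - 1 / (m : ℝ)) ^ 2 = z ^ 2 := by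
    have h : (m : ℝ) * (m - 1) * (β - 1 / (m : ℝ)) ^ 2 = m * (m - 1) * z ^ 2 := by
      have : (m : ℝ) * (m - 1) * (β - 1 / (m : ℝ)) ^ 2 = p - 1 / (m : ℝ) := by
        rw [hpm, hα']; field_simp; ring
      rw [this, hpz]; ring
    exact mul_left_cancel₀ (by positivity) h
  have hy0 : 0 < β - 1 / (m : ℝ) := by
    rw [sub_pos, div_lt_iff₀ hm0]
    nlinarith
  have := (sq_eq_sq₀ hy0.le hz.le).1 hy
  linarith

/-- A disjoint union of cliques whose sizes satisfy the optimality conditions cannot have all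
its cliques smaller than `1 / n + z`. -/
lemma false_of_clique_sizes {a : ι → ι → ℝ} (ha : IsReflGraph a) {x : ι → ℝ}
    (hx : x ∈ stdSimplex ℝ ι) (hcl : ∀ i j, 0 < x i → 0 < x j → a i j = 1 →
      ∀ k, 0 < x k → a i k = a j k) {n : ℕ} (hn : 2 ≤ n) {z σ : ℝ} (hz0 : 0 < z)
    (hpz : pairMass a x = 1 / (n : ℝ) + n * (n - 1) * z ^ 2)
    (hp1 : pairMass a x < 1 / ((n : ℝ) - 1))
    (hbd : ∀ i, 0 < x i → wdeg a x i < 1 / (n : ℝ) + z)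
    (hlin : ∀ i j, 0 < x i → 0 < x j →
      wdeg a x i ^ 2 - σ * wdeg a x i = wdeg a x j ^ 2 - σ * wdeg a x j)
    (hsmall : ∀ i j, 0 < x i → 0 < x j → wdeg a x i = wdeg a x j →
      wdeg a x i < σ / 2 → a i j = 1) : False := by
  have hn' : (2 : ℝ) ≤ n := by exact_mod_cast hn
  have hn0 : (0 : ℝ) < n := by linarith
  have hn1 : (0 : ℝ) < (n : ℝ) - 1 := by linarith
  have hp0 : 1 / (n : ℝ) < pairMass a x := by
    have : 0 < (n : ℝ) * (n - 1) * z ^ 2 := by positivity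
    linarith
  obtain ⟨m, hm⟩ := exists_nat_wsum_inv_wdeg ha hx hcl
  have hone : wsum x (fun i => 1) = 1 := wsum_const hx 1
  by_cases hall : ∃ i j, 0 < x i ∧ 0 < x j ∧ wdeg a x i < wdeg a x j
  -- By `hlin` only two degrees α < β can occur, with α + β = σ. As α < σ/2, `hsmall` merges all
  -- vertices of degree α into one clique.
  · obtain ⟨i, j, hi, hj, hij⟩ := hall
    set α := wdeg a x i with hα
    set β := wdeg a x j with hβ
    have hval : ∀ k, 0 < x k → (wdeg a x k - α) * (wdeg a x k + α - σ) = 0 := by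
      intro k hk
      have := hlin k i hk hi
      linarith
    have hβα : α + β = σ := by
      have := (mul_eq_zero.1 (hval j hj)).resolve_left (by rw [← hβ]; linarith)
      rw [← hβ] at this
      linarith
    have hα2 : α < σ / 2 := by linarith
    have hαpos : 0 < α := wdeg_pos ha hx hi
    have hβpos : 0 < β := wdeg_pos ha hx hj
    -- a vertex of positive weight has degree `α` or `β` according to its adjacency to `i`
    have hdeg : ∀ k, 0 < x k → (a i k = 1 ∧ wdeg a x k = α) ∨ (a i k = 0 ∧ wdeg a x k = β) := by
      intro k hk
      rcases mul_eq_zero.1 (hval k hk) with h | h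
      · left
        have : wdeg a x k = α := by linarith
        exact ⟨hsmall i k hi hk this.symm hα2, this⟩
      · right
        have hkβ : wdeg a x k = β := by linarith
        refine ⟨?_, hkβ⟩
        rcases ha.zero_or_one i k with h1 | h1
        · exact h1
        · exfalso
          have : wdeg a x k = α := wsum_congr hx fun l hl => (hcl i k hi hk h1 l hl).symm
          linarith
    -- The clique of size α contributes 1 to the sum of reciprocal degrees; the remaining weight 1 −
    -- α has degree β.
    have hmeq : (m : ℝ) = 1 + (1 - α) / β := by
      rw [← hm]
      have : wsum x (fun k => (wdeg a x k)⁻¹) =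
          wsum x (fun k => a i k * (α⁻¹ - β⁻¹) + 1 * β⁻¹) := by
        refine wsum_congr hx fun k hk => ?_
        rcases hdeg k hk with ⟨h1, h2⟩ | ⟨h1, h2⟩ <;> rw [h1, h2] <;> ring
      rw [this, wsum_add, wsum_mul_const, wsum_mul_const, hone]
      change α * _ + _ = _
      field_simp
      ring
    have hpeq : pairMass a x = β + α * (α - β) := by
      have : pairMass a x = wsum x (fun k => a i k * (α - β) + 1 * β) := by
        refine wsum_congr hx fun k hk => ?_
        rcases hdeg k hk with ⟨h1, h2⟩ | ⟨h1, h2⟩ <;> rw [h1, h2] <;> ring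
      rw [this, wsum_add, wsum_mul_const, wsum_mul_const, hone]
      change α * _ + _ = _
      ring
    have hm1 : (m - 1 : ℝ) * β = 1 - α := by rw [hmeq]; field_simp; ring
    have hβ1 : β ≤ 1 := by
      rw [← hone]
      refine wsum_mono hx fun k _ => ?_
      rcases ha.zero_or_one j k with h | h <;> rw [h]
      exact zero_le_one
    have h1 := eq_of_clique_sizes hn hz0 hpz hp1 hαpos (hij.trans_le hβ1) hij hm1 hpeq
    exact (hbd j hj).ne h1
  · push Not at hall
    obtain ⟨i, hi⟩ : ∃ i, 0 < x i := by
      by_contra! h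
      have : ∑ i, x i ≤ 0 := Finset.sum_nonpos fun i _ => h i
      rw [hx.2] at this
      linarith
    -- With all cliques of equal size, p = 1/m, which cannot lie strictly between 1/n and 1/(n − 1).
    have heq : ∀ k, 0 < x k → wdeg a x k = wdeg a x i := fun k hk =>
      le_antisymm (hall i k hi hk) (hall k i hk hi)
    have hp2 : pairMass a x = wdeg a x i := by
      rw [← wsum_const hx (wdeg a x i)]
      exact wsum_congr hx heq
    have hm2 : (wdeg a x i)⁻¹ = m := by
      rw [← hm, ← wsum_const hx (wdeg a x i)⁻¹]
      exact wsum_congr hx fun k hk => by rw [heq k hk]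
    have hp3 : pairMass a x = 1 / (m : ℝ) := by rw [hp2, ← hm2]; simp
    have hmpos : 0 < (m : ℝ) := by rw [← hm2]; exact inv_pos.2 (wdeg_pos ha hx hi)
    rw [hp3] at hp0 hp1
    rw [one_div_lt_one_div hn0 hmpos] at hp0
    rw [one_div_lt_one_div hmpos hn1] at hp1
    have h1 : m < n := by exact_mod_cast hp0
    have h2 : (n : ℝ) < m + 1 := by linarith
    have h3 : n < m + 1 := by exact_mod_cast h2
    omega

/-- Makes the curvature of `cubeMin` linear in a degree difference `t`, whose natural bound is r − q
= nz, so that it can be compared with `wdiff`. -/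
lemma second_order_coeff_mul_sq_le {n z t : ℝ} (hn : 2 ≤ n) (hz : 0 < z) (ht0 : 0 ≤ t)
    (ht : t ≤ n * z) : (n - 2) / (2 * z * n * (n - 1)) * t ^ 2 ≤ 1 / 2 * t := by
  have hn1 : 0 < n - 1 := by linarith
  have hn0 : 0 < n := by linarith
  rw [div_mul_eq_mul_div, div_le_iff₀ (by positivity)]
  have h1 : (n - 2) * t ^ 2 ≤ (n - 1) * t ^ 2 :=
    mul_le_mul_of_nonneg_right (by linarith) (sq_nonneg t)
  have h2 : (n - 1) * t * t ≤ (n - 1) * t * (n * z) :=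
    mul_le_mul_of_nonneg_left ht (by positivity)
  linarith

lemma mem_Ioo_of_quadratic {q r d : ℝ} (hqr : q < r) (h : d ^ 2 - (r + q) * d < -(r * q)) :
    q < d ∧ d < r := by
  constructor
  · by_contra! h'
    nlinarith
  · by_contra! h'
    nlinarith

lemma cubeMin_le_of_minimizer {a : ι → ι → ℝ} (ha : IsReflGraph a) {x : ι → ℝ}
    (hx : x ∈ stdSimplex ℝ ι) {n : ℕ} (hn : 2 ≤ n)
    (hp : pairMass a x ∈ Set.Icc (1 / (n : ℝ)) (1 / ((n : ℝ) - 1)))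
    (hmin : ∀ y ∈ stdSimplex ℝ ι, pairMass a y ∈ Set.Icc (1 / (n : ℝ)) (1 / ((n : ℝ) - 1)) →
      tripleMass a x - cubeMin n (pairMass a x) ≤ tripleMass a y - cubeMin n (pairMass a y)) :
    cubeMin n (pairMass a x) ≤ tripleMass a x := by
  by_contra! hlt
  have hn' : (2 : ℝ) ≤ n := by exact_mod_cast hn
  obtain ⟨N, hN⟩ : ∃ N : ℝ, N = n := ⟨_, rfl⟩
  rw [← hN] at hp hmin hlt hn'
  have hn0 : 0 < N := by linarith
  have hn1 : 0 < N - 1 := by linarith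
  have hsq := sq_pairMass_le_tripleMass ha hx
  obtain ⟨z, hz, hz', hpz⟩ := pair_param hn' hp
  -- At both endpoints `cubeMin` equals p², which never exceeds the triple mass, so a violation has
  -- p in the open interval.
  have hz0 : 0 < z := by
    rcases hz.eq_or_lt with h | h
    · rw [← h] at hpz
      simp only [ne_eq, OfNat.ofNat_ne_zero, not_false_eq_true, zero_pow, mul_zero,
        add_zero] at hpz
      rw [hpz] at hlt hsq
      rw [cubeMin_left] at hlt
      linarith
    · exact h
  have hp1 : pairMass a x < 1 / (N - 1) := by
    refine lt_of_le_of_ne hp.2 fun h => ?_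
    rw [h] at hlt hsq
    rw [cubeMin_right hn'] at hlt
    linarith
  have hopt := fun {i j : ι} (hij : i ≠ j) (hi : 0 < x i) (hj : 0 < x j) =>
    optimality ha hx hn' hz0 hpz hp1 hmin hij hi hj
  set r := 1 / N + z with hr
  set q := 1 / N - (N - 1) * z with hq
  have hrq : 2 / N - (N - 2) * z = r + q := by rw [hr, hq]; ring
  have hrq' : r - q = N * z := by rw [hr, hq]; ring
  have hqr : q < r := by
    have : 0 < N * z := by positivity
    linarith
  -- The extremal sizes are roots of d² − (r + q)d + rq; multiply by d and sum over the cliques.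
  have hF : cubeMin N (pairMass a x) = (r + q) * pairMass a x - r * q := by
    rw [hpz, cubeMin_param hn' hz, hr, hq]; field_simp; ring
  rw [hrq] at hopt
  have hlin : ∀ i j, 0 < x i → 0 < x j →
      wcherry a x i - (r + q) * wdeg a x i = wcherry a x j - (r + q) * wdeg a x j := by
    intro i j hi hj
    by_cases hij : i = j
    · rw [hij]
    · linarith [(hopt hij hi hj).1]
  have hconst : ∀ i, 0 < x i →
      wcherry a x i - (r + q) * wdeg a x i = tripleMass a x - (r + q) * pairMass a x := by
    intro i hi
    rw [tripleMass, pairMass, ← wsum_const_mul, ← wsum_sub]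
    rw [← wsum_const hx (wcherry a x i - (r + q) * wdeg a x i)]
    exact wsum_congr hx fun j hj => hlin i j hi hj
  -- The constant in `hconst` is below −rq by the assumed violation, and d² ≤ `wcherry`, so (d −
  -- q)(d − r) < 0.
  have hbd : ∀ i, 0 < x i → q < wdeg a x i ∧ wdeg a x i < r := by
    intro i hi
    have h1 := hconst i hi
    have h2 := sq_wdeg_le_wcherry ha hx i
    exact mem_Ioo_of_quadratic hqr (by linarith)
  -- For adjacent vertices the second order condition gives `wdiff` ≤ (2/3)t, while t ≤ `wdiff`,
  -- where t is the degree difference. Hence both vanish.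
  have hcl : ∀ i j, 0 < x i → 0 < x j → a i j = 1 → ∀ k, 0 < x k → a i k = a j k := by
    intro i j hi hj haij k hk
    by_cases hij : i = j
    · rw [hij]
    refine adj_eq_of_wdiff_eq_zero hx ?_ hk
    have h1 := (hopt hij hi hj).2
    rw [haij] at h1
    have h2 := abs_wdeg_sub_le_wdiff ha hx i j
    set t := |wdeg a x i - wdeg a x j| with ht
    have ht0 : 0 ≤ t := abs_nonneg _
    have htr : t < r - q := abs_lt.2 ⟨by linarith [(hbd i hi).1, (hbd j hj).2],
      by linarith [(hbd i hi).2, (hbd j hj).1]⟩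
    rw [← sq_abs, ← ht] at h1
    have hKt := second_order_coeff_mul_sq_le hn' hz0 ht0 (hrq' ▸ htr.le)
    have : wdiff a x i j ≤ 2 / 3 * t := by linarith
    linarith
  have hcsq : ∀ i, 0 < x i → wcherry a x i = wdeg a x i ^ 2 := fun i hi =>
    wcherry_eq_sq_of_cliques ha hx hcl hi
  have hsmall : ∀ i j, 0 < x i → 0 < x j → wdeg a x i = wdeg a x j →
      wdeg a x i < (r + q) / 2 → a i j = 1 := by
    intro i j hi hj hd hlt'
    rcases ha.zero_or_one i j with h | h
    · exfalso
      have hij : i ≠ j := by rintro rfl; rw [ha.refl] at h; norm_num at h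
      have h1 := (hopt hij hi hj).2
      rw [h, hd] at h1
      -- Different cliques have disjoint neighbourhoods, and the second order condition becomes d ≥
      -- (r + q)/2.
      have h2 : wdiff a x i j = wdeg a x i + wdeg a x j := by
        rw [wdiff, wdeg, wdeg, ← wsum_add]
        refine wsum_congr hx fun k hk => ?_
        rcases ha.zero_or_one i k with h3 | h3
        · rcases ha.zero_or_one j k with h4 | h4 <;> rw [h3, h4] <;> norm_num
        · have := hcl i k hi hk h3 j hj
          rw [h, ha.symm k j] at this
          rw [h3, ← this]; norm_num
      rw [h2] at h1
      linarith
    · exact h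
  rw [hN] at hpz hp1
  refine false_of_clique_sizes ha hx hcl hn hz0 hpz hp1 (σ := r + q)
    (fun i hi => hN ▸ (hbd i hi).2) (fun i j hi hj => ?_) hsmall
  rw [← hcsq i hi, ← hcsq j hj]
  exact hlin i j hi hj

/-- The sharp lower bound for the density of triples spanning at least two edges in terms of
the edge density. -/
theorem cubeMin_le_tripleMass {a : ι → ι → ℝ} (ha : IsReflGraph a) {x : ι → ℝ}
    (hx : x ∈ stdSimplex ℝ ι) {n : ℕ} (hn : 2 ≤ n)
    (hp : pairMass a x ∈ Set.Icc (1 / (n : ℝ)) (1 / ((n : ℝ) - 1))) :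
    cubeMin n (pairMass a x) ≤ tripleMass a x := by
  have hcF : Continuous (cubeMin n) := by unfold cubeMin; fun_prop
  have hK : IsCompact (stdSimplex ℝ ι ∩
      pairMass a ⁻¹' Set.Icc (1 / (n : ℝ)) (1 / ((n : ℝ) - 1))) :=
    (isCompact_stdSimplex ℝ ι).inter_right (isClosed_Icc.preimage (continuous_pairMass a))
  obtain ⟨y, ⟨hy, hyp⟩, hmin⟩ := hK.exists_isMinOn ⟨x, hx, hp⟩
    ((continuous_tripleMass a).sub (hcF.comp (continuous_pairMass a))).continuousOn
  have h1 := cubeMin_le_of_minimizer ha hy hn hyp fun w hw hwp => hmin ⟨hw, hwp⟩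
  have h2 : tripleMass a y - cubeMin n (pairMass a y) ≤
    tripleMass a x - cubeMin n (pairMass a x) := hmin ⟨hx, hp⟩
  linarith

end Finite

/-! ### Order indicators of three points. -/

section Pointwise

variable {Ω : Type*}

/-- The indicator of `X y ≤ X x`. -/
noncomputable def leInd (X : Ω → ℝ) (x y : Ω) : ℝ := if X y ≤ X x then 1 else 0

/-- The indicator of concordance. -/
noncomputable def concInd (X Y : Ω → ℝ) (x y : Ω) : ℝ :=
  if 0 < (X x - X y) * (Y x - Y y) then 1 else 0

/-- The variables encode two linear orders on three points; `ht` and `ht'` exclude the cyclic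
patterns. What remains is a finite check. -/
lemma majority_perm_sum {u v w u' v' w' : ℝ} (hu : u = 0 ∨ u = 1) (hv : v = 0 ∨ v = 1)
    (hw : w = 0 ∨ w = 1) (hu' : u' = 0 ∨ u' = 1) (hv' : v' = 0 ∨ v' = 1) (hw' : w' = 0 ∨ w' = 1)
    (ht : u = v → w = u) (ht' : u' = v' → w' = u') :
    u * w' + w * u' + (1 - u) * v' + v * (1 - u') + (1 - w) * (1 - v') + (1 - v) * (1 - w') =
      1 + majority (u * u' + (1 - u) * (1 - u')) (v * v' + (1 - v) * (1 - v'))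
        (w * w' + (1 - w) * (1 - w')) := by
  rcases hu with rfl | rfl <;> rcases hv with rfl | rfl <;> rcases hw with rfl | rfl <;>
    first
    | (exfalso; norm_num at ht; done)
    | (rcases hu' with rfl | rfl <;> rcases hv' with rfl | rfl <;> rcases hw' with rfl | rfl <;>
        first
        | (exfalso; norm_num at ht'; done)
        | norm_num [majority])

lemma leInd_zero_or_one (X : Ω → ℝ) (x y : Ω) : leInd X x y = 0 ∨ leInd X x y = 1 := by
  unfold leInd; split_ifs <;> simp

lemma concInd_zero_or_one (X Y : Ω → ℝ) (x y : Ω) : concInd X Y x y = 0 ∨ concInd X Y x y = 1 := by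
  unfold concInd; split_ifs <;> simp

lemma leInd_swap {X : Ω → ℝ} {x y : Ω} (h : X y ≠ X x) : leInd X y x = 1 - leInd X x y := by
  unfold leInd
  rcases lt_or_gt_of_ne h with h | h
  · rw [if_neg (not_le.2 h), if_pos h.le]; norm_num
  · rw [if_pos h.le, if_neg (not_le.2 h)]; norm_num

lemma leInd_trans {X : Ω → ℝ} {x y z : Ω} (h1 : X y ≠ X x) (h2 : X z ≠ X y)
    (h : leInd X x y = leInd X y z) : leInd X x z = leInd X x y := by
  unfold leInd at *
  rcases lt_or_gt_of_ne h1 with h1 | h1 <;> rcases lt_or_gt_of_ne h2 with h2 | h2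
  · rw [if_pos h1.le, if_pos (h2.trans h1).le]
  · rw [if_pos h1.le, if_neg (not_le.2 h2)] at h; norm_num at h
  · rw [if_neg (not_le.2 h1), if_pos h2.le] at h; norm_num at h
  · rw [if_neg (not_le.2 h1), if_neg (not_le.2 (h1.trans h2))]

lemma concInd_eq {X Y : Ω → ℝ} {x y : Ω} (h : X y ≠ X x) (h' : Y y ≠ Y x) :
    concInd X Y x y = leInd X x y * leInd Y x y + (1 - leInd X x y) * (1 - leInd Y x y) := by
  unfold concInd leInd
  rcases lt_or_gt_of_ne h with h | h <;> rcases lt_or_gt_of_ne h' with h' | h'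
  · rw [if_pos (mul_pos (sub_pos.2 h) (sub_pos.2 h')), if_pos h.le, if_pos h'.le]; norm_num
  · rw [if_neg (by nlinarith), if_pos h.le, if_neg (not_le.2 h')]; norm_num
  · rw [if_neg (by nlinarith), if_neg (not_le.2 h), if_pos h'.le]; norm_num
  · rw [if_pos (mul_pos_of_neg_of_neg (sub_neg.2 h) (sub_neg.2 h')), if_neg (not_le.2 h),
      if_neg (not_le.2 h')]; norm_num

lemma leInd_perm_sum {X Y : Ω → ℝ} {x y z : Ω} (h1 : X y ≠ X x) (h2 : X z ≠ X y) (h3 : X z ≠ X x)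
    (h1' : Y y ≠ Y x) (h2' : Y z ≠ Y y) (h3' : Y z ≠ Y x) :
    leInd X x y * leInd Y x z + leInd X x z * leInd Y x y + leInd X y x * leInd Y y z +
      leInd X y z * leInd Y y x + leInd X z x * leInd Y z y + leInd X z y * leInd Y z x =
      1 + majority (concInd X Y x y) (concInd X Y y z) (concInd X Y x z) := by
  rw [leInd_swap h1, leInd_swap h2, leInd_swap h3, leInd_swap h1', leInd_swap h2', leInd_swap h3',
    concInd_eq h1 h1', concInd_eq h2 h2', concInd_eq h3 h3']
  exact majority_perm_sum (leInd_zero_or_one ..) (leInd_zero_or_one ..) (leInd_zero_or_one ..)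
    (leInd_zero_or_one ..) (leInd_zero_or_one ..) (leInd_zero_or_one ..)
    (leInd_trans h1 h2) (leInd_trans h1' h2')

lemma norm_le_one_of_zero_or_one {u : ℝ} (hu : u = 0 ∨ u = 1) : ‖u‖ ≤ 1 := by
  rcases hu with rfl | rfl <;> simp

lemma norm_majority_le {u v w : ℝ} (hu : u = 0 ∨ u = 1) (hv : v = 0 ∨ v = 1)
    (hw : w = 0 ∨ w = 1) : ‖majority u v w‖ ≤ 1 := by
  rcases hu with rfl | rfl <;> rcases hv with rfl | rfl <;> rcases hw with rfl | rfl <;>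
    norm_num [majority]

end Pointwise

/-! ### Integrals over three independent points. -/

section Triple

variable {Ω : Type*} [MeasurableSpace Ω]

/-- The integral of a function of three independent points. -/
noncomputable def tripleIntegral (P : Measure Ω) (f : Ω → Ω → Ω → ℝ) : ℝ :=
  ∫ x, ∫ y, ∫ z, f x y z ∂P ∂P ∂P

/-- `f` is jointly measurable and bounded by `C`. -/
structure IsBddMeas (f : Ω → Ω → Ω → ℝ) (C : ℝ) : Prop where
  meas : Measurable fun t : Ω × Ω × Ω => f t.1 t.2.1 t.2.2
  bdd : ∀ x y z, ‖f x y z‖ ≤ C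

namespace IsBddMeas

variable {f g : Ω → Ω → Ω → ℝ} {C D : ℝ}

lemma swap_right (hf : IsBddMeas f C) : IsBddMeas (fun x y z => f x z y) C :=
  ⟨hf.meas.comp (f := fun t : Ω × Ω × Ω => (t.1, t.2.2, t.2.1)) (by fun_prop),
    fun x y z => hf.bdd x z y⟩

lemma swap_left (hf : IsBddMeas f C) : IsBddMeas (fun x y z => f y x z) C :=
  ⟨hf.meas.comp (f := fun t : Ω × Ω × Ω => (t.2.1, t.1, t.2.2)) (by fun_prop),
    fun x y z => hf.bdd y x z⟩

lemma add (hf : IsBddMeas f C) (hg : IsBddMeas g D) :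
    IsBddMeas (fun x y z => f x y z + g x y z) (C + D) :=
  ⟨hf.meas.add hg.meas, fun x y z =>
    (norm_add_le _ _).trans (add_le_add (hf.bdd x y z) (hg.bdd x y z))⟩

variable {P : Measure Ω} [IsProbabilityMeasure P]

lemma integrable_section (hf : IsBddMeas f C) (x y : Ω) : Integrable (f x y) P :=
  Integrable.of_bound (hf.meas.comp (f := fun z => (x, y, z))
    (by fun_prop)).aestronglyMeasurable C (.of_forall fun z => hf.bdd x y z)

lemma integrable_section₂ (hf : IsBddMeas f C) (x : Ω) :
    Integrable (Function.uncurry (f x)) (P.prod P) :=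
  Integrable.of_bound (hf.meas.comp (f := fun t : Ω × Ω => (x, t))
    (by fun_prop)).aestronglyMeasurable C (.of_forall fun z => hf.bdd x _ _)

lemma stronglyMeasurable_inner (hf : IsBddMeas f C) :
    StronglyMeasurable fun t : Ω × Ω => ∫ z, f t.1 t.2 z ∂P :=
  StronglyMeasurable.integral_prod_right' (f := fun t : (Ω × Ω) × Ω => f t.1.1 t.1.2 t.2)
    (hf.meas.comp (f := fun t : (Ω × Ω) × Ω => (t.1.1, t.1.2, t.2))
      (by fun_prop)).stronglyMeasurable

lemma norm_inner_le (hf : IsBddMeas f C) (x y : Ω) : ‖∫ z, f x y z ∂P‖ ≤ C := by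
  simpa using norm_integral_le_of_norm_le_const (.of_forall fun z => hf.bdd x y z) (μ := P)

lemma integrable_inner (hf : IsBddMeas f C) :
    Integrable (Function.uncurry fun x y => ∫ z, f x y z ∂P) (P.prod P) :=
  Integrable.of_bound hf.stronglyMeasurable_inner.aestronglyMeasurable C
    (.of_forall fun _ => hf.norm_inner_le _ _)

lemma integrable_inner_section (hf : IsBddMeas f C) (x : Ω) :
    Integrable (fun y => ∫ z, f x y z ∂P) P :=
  Integrable.of_bound ((hf.stronglyMeasurable_inner (P := P)).comp_measurable
    (g := fun y => (x, y)) (by fun_prop)).aestronglyMeasurable C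
    (.of_forall fun _ => hf.norm_inner_le _ _)

lemma integrable_outer (hf : IsBddMeas f C) : Integrable (fun x => ∫ y, ∫ z, f x y z ∂P ∂P) P :=
  (hf.integrable_inner (P := P)).integral_prod_left

lemma norm_outer_le (hf : IsBddMeas f C) (x : Ω) : ‖∫ y, ∫ z, f x y z ∂P ∂P‖ ≤ C := by
  simpa using norm_integral_le_of_norm_le_const
    (.of_forall fun y => hf.norm_inner_le (P := P) x y) (μ := P)

lemma tripleIntegral_swap_right (hf : IsBddMeas f C) :
    tripleIntegral P (fun x y z => f x z y) = tripleIntegral P f := by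
  unfold tripleIntegral
  congr 1
  ext x
  exact integral_integral_swap (hf.swap_right.integrable_section₂ x)

lemma tripleIntegral_swap_left (hf : IsBddMeas f C) :
    tripleIntegral P (fun x y z => f y x z) = tripleIntegral P f :=
  integral_integral_swap hf.swap_left.integrable_inner

lemma tripleIntegral_add (hf : IsBddMeas f C) (hg : IsBddMeas g D) :
    tripleIntegral P (fun x y z => f x y z + g x y z) =
      tripleIntegral P f + tripleIntegral P g := by
  unfold tripleIntegral
  rw [← integral_add hf.integrable_outer hg.integrable_outer]
  congr 1
  ext x
  rw [← integral_add (hf.integrable_inner_section x) (hg.integrable_inner_section x)]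
  congr 1
  ext y
  exact integral_add (hf.integrable_section x y) (hg.integrable_section x y)

lemma tendsto_tripleIntegral {F : ℕ → Ω → Ω → Ω → ℝ} (hF : ∀ m, IsBddMeas (F m) C)
    (h : ∀ x, ∀ᵐ y ∂P, ∀ᵐ z ∂P,
      Filter.Tendsto (fun m => F m x y z) Filter.atTop (nhds (f x y z))) :
    Filter.Tendsto (fun m => tripleIntegral P (F m)) Filter.atTop (nhds (tripleIntegral P f)) := by
  refine tendsto_integral_of_dominated_convergence (fun _ => C)
    (fun m => (hF m).integrable_outer.aestronglyMeasurable) (integrable_const C)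
    (fun m => .of_forall fun x => (hF m).norm_outer_le x) (.of_forall fun x => ?_)
  refine tendsto_integral_of_dominated_convergence (fun _ => C)
    (fun m => ((hF m).integrable_inner_section x).aestronglyMeasurable) (integrable_const C)
    (fun m => .of_forall fun y => (hF m).norm_inner_le x y) ?_
  filter_upwards [h x] with y hy
  exact tendsto_integral_of_dominated_convergence (fun _ => C)
    (fun m => ((hF m).integrable_section x y).aestronglyMeasurable) (integrable_const C)
    (fun m => .of_forall fun z => (hF m).bdd x y z) hy

end IsBddMeas

lemma tripleIntegral_congr {P : Measure Ω} {f g : Ω → Ω → Ω → ℝ}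
    (h : ∀ x, ∀ᵐ y ∂P, ∀ᵐ z ∂P, f x y z = g x y z) : tripleIntegral P f = tripleIntegral P g := by
  unfold tripleIntegral
  congr 1
  ext x
  refine integral_congr_ae ?_
  filter_upwards [h x] with y hy using integral_congr_ae hy

lemma tripleIntegral_const {P : Measure Ω} [IsProbabilityMeasure P] (c : ℝ) :
    tripleIntegral P (fun _ _ _ => c) = c := by
  simp [tripleIntegral]

/-- The probability that two independent points are concordant. -/
noncomputable def concProb (P : Measure Ω) (X Y : Ω → ℝ) : ℝ :=
  tripleIntegral P fun x y _ => concInd X Y x y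

/-- The probability that three independent points form at least two concordant pairs. -/
noncomputable def concTripleProb (P : Measure Ω) (X Y : Ω → ℝ) : ℝ :=
  tripleIntegral P fun x y z => majority (concInd X Y x y) (concInd X Y y z) (concInd X Y x z)

lemma measurable_leInd {X : Ω → ℝ} (hX : Measurable X) :
    Measurable fun t : Ω × Ω => leInd X t.1 t.2 :=
  Measurable.ite (measurableSet_le (by fun_prop) (by fun_prop)) measurable_const measurable_const

lemma measurable_concInd {X Y : Ω → ℝ} (hX : Measurable X) (hY : Measurable Y) :
    Measurable fun t : Ω × Ω => concInd X Y t.1 t.2 :=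
  Measurable.ite (measurableSet_lt (by fun_prop) (by fun_prop)) measurable_const measurable_const

lemma isBddMeas_leInd {X Y : Ω → ℝ} (hX : Measurable X) (hY : Measurable Y) :
    IsBddMeas (fun x y z => leInd X x y * leInd Y x z) 1 := by
  refine ⟨((measurable_leInd hX).comp (f := fun t : Ω × Ω × Ω => (t.1, t.2.1)) (by fun_prop)).mul
    ((measurable_leInd hY).comp (f := fun t : Ω × Ω × Ω => (t.1, t.2.2)) (by fun_prop)),
    fun x y z => ?_⟩
  rw [norm_mul]
  exact mul_le_one₀ (norm_le_one_of_zero_or_one (leInd_zero_or_one ..)) (norm_nonneg _)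
    (norm_le_one_of_zero_or_one (leInd_zero_or_one ..))

lemma isBddMeas_majority {e : Ω → Ω → ℝ} (he : Measurable fun t : Ω × Ω => e t.1 t.2)
    (h01 : ∀ x y, e x y = 0 ∨ e x y = 1) :
    IsBddMeas (fun x y z => majority (e x y) (e y z) (e x z)) 1 := by
  refine ⟨?_, fun x y z => norm_majority_le (h01 _ _) (h01 _ _) (h01 _ _)⟩
  have h1 : Measurable fun t : Ω × Ω × Ω => e t.1 t.2.1 :=
    he.comp (f := fun t : Ω × Ω × Ω => (t.1, t.2.1)) (by fun_prop)
  have h2 : Measurable fun t : Ω × Ω × Ω => e t.2.1 t.2.2 :=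
    he.comp (f := fun t : Ω × Ω × Ω => (t.2.1, t.2.2)) (by fun_prop)
  have h3 : Measurable fun t : Ω × Ω × Ω => e t.1 t.2.2 :=
    he.comp (f := fun t : Ω × Ω × Ω => (t.1, t.2.2)) (by fun_prop)
  unfold majority
  fun_prop

lemma isBddMeas_pair {e : Ω → Ω → ℝ} (he : Measurable fun t : Ω × Ω => e t.1 t.2)
    (h01 : ∀ x y, e x y = 0 ∨ e x y = 1) : IsBddMeas (fun x y _ => e x y) 1 :=
  ⟨he.comp (f := fun t : Ω × Ω × Ω => (t.1, t.2.1)) (by fun_prop),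
    fun x y _ => norm_le_one_of_zero_or_one (h01 x y)⟩

/-- `X` has no atoms. -/
def IsAtomless (P : Measure Ω) (X : Ω → ℝ) : Prop := ∀ c, ∀ᵐ ω ∂P, X ω ≠ c

variable {P : Measure Ω} [IsProbabilityMeasure P] {X Y : Ω → ℝ}

/-- The integral on the left is E[F(X)G(Y)]. It is invariant under the six permutations of the
points, and away from ties, which are null, the six integrands add up to one plus the majority. -/
lemma six_mul_tripleIntegral_leInd (hX : Measurable X) (hY : Measurable Y)
    (haX : IsAtomless P X) (haY : IsAtomless P Y) :
    6 * tripleIntegral P (fun x y z => leInd X x y * leInd Y x z) = 1 + concTripleProb P X Y := by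
  have h1 := isBddMeas_leInd hX hY
  have h2 := h1.swap_right
  have h3 := h1.swap_left
  have h4 := h2.swap_left
  have h5 := h3.swap_right
  have h6 := h4.swap_right
  have e2 := h1.tripleIntegral_swap_right (P := P)
  have e3 := h1.tripleIntegral_swap_left (P := P)
  have e4 := h2.tripleIntegral_swap_left (P := P)
  have e5 := h3.tripleIntegral_swap_right (P := P)
  have e6 := h4.tripleIntegral_swap_right (P := P)
  have s := ((((h1.add h2).add h3).add h4).add h5).tripleIntegral_add (P := P) h6
  rw [((((h1.add h2).add h3).add h4)).tripleIntegral_add (P := P) h5,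
    (((h1.add h2).add h3)).tripleIntegral_add (P := P) h4,
    ((h1.add h2)).tripleIntegral_add (P := P) h3, h1.tripleIntegral_add (P := P) h2] at s
  have hm := isBddMeas_majority (measurable_concInd hX hY) (concInd_zero_or_one X Y)
  have hc : IsBddMeas (fun _ _ _ : Ω => (1 : ℝ)) 1 := ⟨measurable_const, fun _ _ _ => by simp⟩
  have t := hc.tripleIntegral_add (P := P) hm
  rw [tripleIntegral_const] at t
  rw [concTripleProb, ← t]
  rw [e6, e5, e4, e3, e2] at s
  have key : tripleIntegral P (fun x y z =>
      leInd X x y * leInd Y x z + leInd X x z * leInd Y x y + leInd X y x * leInd Y y z +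
      leInd X y z * leInd Y y x + leInd X z x * leInd Y z y + leInd X z y * leInd Y z x) =
      tripleIntegral P (fun x y z =>
        1 + majority (concInd X Y x y) (concInd X Y y z) (concInd X Y x z)) := by
    refine tripleIntegral_congr fun x => ?_
    filter_upwards [haX (X x), haY (Y x)] with y hy hy'
    filter_upwards [haX (X x), haY (Y x), haX (X y), haY (Y y)] with z hz hz' hw hw'
    exact leInd_perm_sum hy hw hz hy' hw' hz'
  rw [← key]
  linarith

end Triple

/-! ### Discretisation of the plane into cells. -/

section Cells

variable {Ω : Type*}

/-- The index of the cell of `c` in a partition of the real line into `m + 1` intervals. -/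
noncomputable def cellIndex (m : ℕ) (c : ℝ) : Fin (m + 1) :=
  ⟨⌊(m : ℝ) * Real.sigmoid c⌋₊, by
    rw [Nat.lt_succ_iff]
    refine Nat.floor_le_of_le ?_
    exact mul_le_of_le_one_right (Nat.cast_nonneg m) (Real.sigmoid_le_one c)⟩

lemma cellIndex_mono (m : ℕ) : Monotone (cellIndex m) := by
  intro c d h
  refine Fin.mk_le_mk.2 (Nat.floor_le_floor ?_)
  exact mul_le_mul_of_nonneg_left (Real.sigmoid_monotone h) (Nat.cast_nonneg m)

lemma measurable_cellIndex (m : ℕ) : Measurable (cellIndex m) := (cellIndex_mono m).measurable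

lemma eventually_cellIndex_lt {c d : ℝ} (h : c < d) :
    ∀ᶠ m in Filter.atTop, cellIndex m c < cellIndex m d := by
  have h1 : 0 < Real.sigmoid d - Real.sigmoid c := sub_pos.2 (Real.sigmoid_strictMono h)
  have h2 : Filter.Tendsto (fun m : ℕ => (m : ℝ) * (Real.sigmoid d - Real.sigmoid c))
      Filter.atTop Filter.atTop := tendsto_natCast_atTop_atTop.atTop_mul_const h1
  filter_upwards [h2.eventually_ge_atTop 1] with m hm
  refine Fin.mk_lt_mk.2 ?_
  rw [← Nat.add_one_le_iff, ← Nat.floor_add_one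
    (mul_nonneg (Nat.cast_nonneg m) (Real.sigmoid_nonneg c))]
  exact Nat.floor_le_floor (by linarith)

/-- The graph on cells: strictly concordant cells are adjacent. -/
def cellAdj (m : ℕ) (u v : Fin (m + 1) × Fin (m + 1)) : ℝ :=
  if u = v ∨ (u.1 < v.1 ∧ u.2 < v.2) ∨ (v.1 < u.1 ∧ v.2 < u.2) then 1 else 0

lemma isReflGraph_cellAdj (m : ℕ) : IsReflGraph (cellAdj m) where
  symm u v := by
    unfold cellAdj
    refine if_congr ?_ rfl rfl
    rw [eq_comm, or_comm (a := u.1 < v.1 ∧ u.2 < v.2)]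
  refl u := by simp [cellAdj]
  zero_or_one u v := by unfold cellAdj; split_ifs <;> simp

/-- The cell of a point. -/
noncomputable def cell (X Y : Ω → ℝ) (m : ℕ) (ω : Ω) : Fin (m + 1) × Fin (m + 1) :=
  (cellIndex m (X ω), cellIndex m (Y ω))

/-- Once the cells are fine enough, the two points differ strictly in both cell coordinates, in the
same order as their values. -/
lemma eventually_cellAdj_eq {X Y : Ω → ℝ} {x y : Ω} (h : X y ≠ X x) (h' : Y y ≠ Y x) :
    ∀ᶠ m in Filter.atTop, cellAdj m (cell X Y m x) (cell X Y m y) = concInd X Y x y := by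
  unfold cellAdj concInd cell
  rcases lt_or_gt_of_ne h with h | h <;> rcases lt_or_gt_of_ne h' with h' | h' <;>
    filter_upwards [eventually_cellIndex_lt h, eventually_cellIndex_lt h'] with m h1 h2
  · rw [if_pos (.inr (.inr ⟨h1, h2⟩)), if_pos (mul_pos (sub_pos.2 h) (sub_pos.2 h'))]
  · rw [if_neg, if_neg (by nlinarith)]
    simp [Prod.ext_iff, h1.ne', h1.not_gt, h2.not_gt]
  · rw [if_neg, if_neg (by nlinarith)]
    simp [Prod.ext_iff, h1.ne, h1.not_gt, h2.not_gt]
  · rw [if_pos (.inr (.inl ⟨h1, h2⟩)), if_pos (mul_pos_of_neg_of_neg (sub_neg.2 h) (sub_neg.2 h'))]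

end Cells

/-! ### Kendall's τ and Spearman's ρ through concordance, and passage to the limit. -/

section Coefficients

variable {Ω : Type*} [MeasurableSpace Ω]

lemma IsContinuousRV.isAtomless {P : Measure Ω} [IsProbabilityMeasure P] {X : Ω → ℝ}
    (hX : IsContinuousRV P X) : IsAtomless P X := by
  intro c
  have : IsProbabilityMeasure (P.map X) := Measure.isProbabilityMeasure_map hX.1.aemeasurable
  have h : (P.map X) {c} = 0 := by
    rw [← measure_cdf (P.map X), StieltjesFunction.measure_singleton,
      ((cdf (P.map X)).mono.continuousAt_iff_leftLim_eq_rightLim.1 hX.2.continuousAt),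
      StieltjesFunction.rightLim_eq, sub_self, ENNReal.ofReal_zero]
  rw [Measure.map_apply hX.1 (measurableSet_singleton c)] at h
  exact measure_eq_zero_iff_ae_notMem.1 h

lemma IsAtomless.isContinuousRV {P : Measure Ω} [IsProbabilityMeasure P] {X : Ω → ℝ}
    (hX : Measurable X) (h : IsAtomless P X) : IsContinuousRV P X := by
  refine ⟨hX, continuous_iff_continuousAt.2 fun c => ?_⟩
  have : IsProbabilityMeasure (P.map X) := Measure.isProbabilityMeasure_map hX.aemeasurable
  have h0 : (P.map X) {c} = 0 := by
    rw [Measure.map_apply hX (measurableSet_singleton c)]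
    exact measure_eq_zero_iff_ae_notMem.2 (h c)
  rw [← measure_cdf (P.map X), StieltjesFunction.measure_singleton, ENNReal.ofReal_eq_zero] at h0
  rw [(cdf (P.map X)).mono.continuousAt_iff_leftLim_eq_rightLim, StieltjesFunction.rightLim_eq]
  exact le_antisymm ((cdf (P.map X)).mono.leftLim_le le_rfl) (by linarith)

lemma measurable_cdf_comp {P : Measure Ω} {X : Ω → ℝ} (hX : Measurable X) :
    Measurable fun ω => cdf (P.map X) (X ω) :=
  (cdf (P.map X)).mono.measurable.comp hX

lemma concTripleProb_nonneg {P : Measure Ω} {X Y : Ω → ℝ} : 0 ≤ concTripleProb P X Y :=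
  integral_nonneg fun _ => integral_nonneg fun _ => integral_nonneg fun _ =>
    (majority_nonneg (concInd_zero_or_one ..) (concInd_zero_or_one ..)
      (concInd_zero_or_one ..)).1

variable {P : Measure Ω} [IsProbabilityMeasure P] {X Y : Ω → ℝ}

lemma prod_real_setOf {p : Ω × Ω → Prop} [DecidablePred p] (hp : MeasurableSet {t | p t}) :
    (P.prod P).real {t | p t} = tripleIntegral P fun x y _ => if p (x, y) then 1 else 0 := by
  rw [← integral_indicator_one hp, integral_prod]
  · simp [tripleIntegral, Set.indicator_apply]
  · exact (integrable_const (1 : ℝ)).indicator hp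

lemma kendallTau_eq (hX : Measurable X) (hY : Measurable Y)
    (haX : IsAtomless P X) (haY : IsAtomless P Y) : kendallTau P X Y = 2 * concProb P X Y - 1 := by
  have h1 : (P.prod P).real {p | (X p.1 - X p.2) * (Y p.1 - Y p.2) > 0} = concProb P X Y :=
    prod_real_setOf (measurableSet_lt (by fun_prop) (by fun_prop))
  have h2 : (P.prod P).real {p | (X p.1 - X p.2) * (Y p.1 - Y p.2) < 0} =
      tripleIntegral P fun x y _ => if (X x - X y) * (Y x - Y y) < 0 then 1 else 0 :=
    prod_real_setOf (measurableSet_lt (by fun_prop) (by fun_prop))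
  have hb := isBddMeas_pair (measurable_concInd hX hY) (concInd_zero_or_one X Y)
  have hb' : IsBddMeas (fun x y (_ : Ω) => if (X x - X y) * (Y x - Y y) < 0 then (1 : ℝ) else 0)
      1 := by
    refine isBddMeas_pair (e := fun x y => if (X x - X y) * (Y x - Y y) < 0 then (1 : ℝ) else 0)
      (Measurable.ite (measurableSet_lt (by fun_prop) (by fun_prop))
        measurable_const measurable_const) fun x y => ?_
    split_ifs <;> simp
  have h3 := hb.tripleIntegral_add (P := P) hb'
  have h4 : tripleIntegral P (fun x y _ => concInd X Y x y +
      if (X x - X y) * (Y x - Y y) < 0 then (1 : ℝ) else 0) = 1 := by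
    refine (tripleIntegral_congr fun x => ?_).trans (tripleIntegral_const (P := P) 1)
    filter_upwards [haX (X x), haY (Y x)] with y hy hy'
    refine .of_forall fun z => ?_
    have : (X x - X y) * (Y x - Y y) ≠ 0 :=
      mul_ne_zero (sub_ne_zero.2 hy.symm) (sub_ne_zero.2 hy'.symm)
    unfold concInd
    rcases lt_or_gt_of_ne this with h | h
    · rw [if_neg h.not_gt, if_pos h, zero_add]
    · rw [if_pos h, if_neg h.not_gt, add_zero]
  rw [kendallTau, h1, h2]
  rw [h4] at h3
  unfold concProb
  linarith

lemma cdf_map_eq (hX : Measurable X) (x : Ω) :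
    cdf (P.map X) (X x) = ∫ y, leInd X x y ∂P := by
  have : IsProbabilityMeasure (P.map X) := Measure.isProbabilityMeasure_map hX.aemeasurable
  rw [cdf_eq_real, map_measureReal_apply hX measurableSet_Iic,
    ← integral_indicator_one (hX measurableSet_Iic)]
  refine integral_congr_ae (.of_forall fun y => ?_)
  simp [leInd, Set.indicator]

lemma memLp_cdf_comp (hX : Measurable X) : MemLp (fun ω => cdf (P.map X) (X ω)) 2 P := by
  refine MemLp.of_bound (measurable_cdf_comp hX).aestronglyMeasurable 1 (.of_forall fun ω => ?_)
  rw [Real.norm_of_nonneg (cdf_nonneg _ _)]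
  exact cdf_le_one _ _

lemma integral_cdf_comp (hX : Measurable X) (haX : IsAtomless P X) :
    ∫ ω, cdf (P.map X) (X ω) ∂P = 1 / 2 := by
  have h1 : ∫ ω, cdf (P.map X) (X ω) ∂P = tripleIntegral P fun x y _ => leInd X x y := by
    simp [tripleIntegral, cdf_map_eq hX]
  have hb := isBddMeas_pair (measurable_leInd hX) (leInd_zero_or_one X)
  have h2 := hb.tripleIntegral_add (P := P) hb.swap_left
  rw [hb.tripleIntegral_swap_left] at h2
  have h3 : tripleIntegral P (fun x y _ => leInd X x y + leInd X y x) = 1 := by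
    rw [← tripleIntegral_const (P := P) 1]
    refine tripleIntegral_congr fun x => ?_
    filter_upwards [haX (X x)] with y hy
    exact .of_forall fun z => by rw [leInd_swap hy]; ring
  rw [h1]
  linarith

lemma covariance_cdf_comp (hX : Measurable X) (hY : Measurable Y)
    (haX : IsAtomless P X) (haY : IsAtomless P Y) :
    covariance (fun ω => cdf (P.map X) (X ω)) (fun ω => cdf (P.map Y) (Y ω)) P =
      concTripleProb P X Y / 6 - 1 / 12 := by
  rw [covariance_eq_sub (memLp_cdf_comp hX) (memLp_cdf_comp hY), integral_cdf_comp hX haX,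
    integral_cdf_comp hY haY]
  have h : ∫ ω, ((fun ω => cdf (P.map X) (X ω)) * fun ω => cdf (P.map Y) (Y ω)) ω ∂P =
      tripleIntegral P (fun x y z => leInd X x y * leInd Y x z) := by
    unfold tripleIntegral
    congr 1
    ext x
    simp only [integral_const_mul, integral_mul_const, Pi.mul_apply, cdf_map_eq hX, cdf_map_eq hY]
  have h6 := six_mul_tripleIntegral_leInd hX hY haX haY
  rw [h]
  linarith

/-- With this, the covariance formula for the pair (X, X) yields the variance 1/12 of F(X), without
identifying its law as uniform. -/
lemma concTripleProb_self (haX : IsAtomless P X) : concTripleProb P X X = 1 := by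
  rw [← tripleIntegral_const (P := P) 1]
  have h : ∀ {x y}, X y ≠ X x → concInd X X x y = 1 := fun hy =>
    if_pos (mul_self_pos.2 (sub_ne_zero.2 hy.symm))
  refine tripleIntegral_congr fun x => ?_
  filter_upwards [haX (X x)] with y hy
  filter_upwards [haX (X x), haX (X y)] with z hz hz'
  rw [h hy, h hz, h hz']
  norm_num [majority]

lemma variance_cdf_comp (hX : Measurable X) (haX : IsAtomless P X) :
    variance (fun ω => cdf (P.map X) (X ω)) P = 1 / 12 := by
  rw [← covariance_self (measurable_cdf_comp hX).aemeasurable,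
    covariance_cdf_comp hX hX haX haX, concTripleProb_self haX]
  norm_num

lemma spearmanRho_eq (hX : Measurable X) (hY : Measurable Y)
    (haX : IsAtomless P X) (haY : IsAtomless P Y) :
    spearmanRho P X Y = 2 * concTripleProb P X Y - 1 := by
  rw [spearmanRho, pearsonCorr, covariance_cdf_comp hX hY haX haY, variance_cdf_comp hX haX,
    variance_cdf_comp hY haY, Real.mul_self_sqrt (by norm_num)]
  ring

/-- The distribution of a random variable with values in a finite type. -/
noncomputable def weights {ι : Type*} (P : Measure Ω) (c : Ω → ι) (i : ι) : ℝ := P.real (c ⁻¹' {i})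

variable {ι : Type*} [Fintype ι] [MeasurableSpace ι] [MeasurableSingletonClass ι]

lemma integral_comp_eq_wsum {c : Ω → ι} (hc : Measurable c) (f : ι → ℝ) :
    ∫ ω, f (c ω) ∂P = wsum (weights P c) f := by
  have : IsProbabilityMeasure (P.map c) := Measure.isProbabilityMeasure_map hc.aemeasurable
  rw [← integral_map hc.aemeasurable (Measurable.of_discrete).aestronglyMeasurable,
    integral_fintype .of_finite]
  refine Finset.sum_congr rfl fun i _ => ?_
  rw [map_measureReal_apply hc (measurableSet_singleton i), smul_eq_mul, weights]

lemma weights_mem_stdSimplex {c : Ω → ι} (hc : Measurable c) : weights P c ∈ stdSimplex ℝ ι := by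
  refine ⟨fun i => measureReal_nonneg, ?_⟩
  have := integral_comp_eq_wsum (P := P) hc fun _ => 1
  simpa [wsum] using this.symm

lemma tripleIntegral_pair_comp {c : Ω → ι} (hc : Measurable c) (a : ι → ι → ℝ) :
    tripleIntegral P (fun x y _ => a (c x) (c y)) = pairMass a (weights P c) := by
  simp only [tripleIntegral, integral_const, probReal_univ, one_smul]
  simp_rw [fun x => integral_comp_eq_wsum (P := P) hc (fun i => a (c x) i)]
  exact integral_comp_eq_wsum hc fun i => wdeg a (weights P c) i

lemma tripleIntegral_majority_comp {c : Ω → ι} (hc : Measurable c) (a : ι → ι → ℝ) :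
    tripleIntegral P (fun x y z => majority (a (c x) (c y)) (a (c y) (c z)) (a (c x) (c z))) =
      tripleMass a (weights P c) := by
  unfold tripleIntegral
  simp_rw [fun x y => integral_comp_eq_wsum (P := P) hc
    (fun i => majority (a (c x) (c y)) (a (c y) i) (a (c x) i))]
  simp_rw [fun x => integral_comp_eq_wsum (P := P) hc (fun j => wsum (weights P c)
    fun i => majority (a (c x) j) (a j i) (a (c x) i))]
  exact integral_comp_eq_wsum hc fun i => wcherry a (weights P c) i

/-- The sharp lower bound for the concordance probability of triples. -/
theorem cubeMin_le_concTripleProb (hX : Measurable X) (hY : Measurable Y)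
    (haX : IsAtomless P X) (haY : IsAtomless P Y) {n : ℕ} (hn : 2 ≤ n)
    (hp : concProb P X Y ∈ Set.Icc (1 / (n : ℝ)) (1 / ((n : ℝ) - 1))) :
    cubeMin n (concProb P X Y) ≤ concTripleProb P X Y := by
  have hn' : (2 : ℝ) ≤ n := by exact_mod_cast hn
  have hc : ∀ m, Measurable (cell X Y m) := fun m =>
    ((measurable_cellIndex m).comp hX).prodMk ((measurable_cellIndex m).comp hY)
  have hme : ∀ m, Measurable fun t : Ω × Ω => cellAdj m (cell X Y m t.1) (cell X Y m t.2) :=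
    fun m => (Measurable.of_discrete (f := Function.uncurry (cellAdj m))).comp
      (((hc m).comp measurable_fst).prodMk ((hc m).comp measurable_snd))
  have h01 : ∀ m x y, cellAdj m (cell X Y m x) (cell X Y m y) = 0 ∨
      cellAdj m (cell X Y m x) (cell X Y m y) = 1 :=
    fun m x y => (isReflGraph_cellAdj m).zero_or_one _ _
  have hpair : Filter.Tendsto (fun m => pairMass (cellAdj m) (weights P (cell X Y m)))
      Filter.atTop (nhds (concProb P X Y)) := by
    simp_rw [← fun m => tripleIntegral_pair_comp (P := P) (hc m) (cellAdj m)]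
    refine IsBddMeas.tendsto_tripleIntegral (fun m => isBddMeas_pair (hme m) (h01 m)) fun x => ?_
    filter_upwards [haX (X x), haY (Y x)] with y hy hy'
    exact .of_forall fun z => tendsto_nhds_of_eventually_eq (eventually_cellAdj_eq hy hy')
  have htriple : Filter.Tendsto (fun m => tripleMass (cellAdj m) (weights P (cell X Y m)))
      Filter.atTop (nhds (concTripleProb P X Y)) := by
    simp_rw [← fun m => tripleIntegral_majority_comp (P := P) (hc m) (cellAdj m)]
    refine IsBddMeas.tendsto_tripleIntegral
      (fun m => isBddMeas_majority (hme m) (h01 m)) fun x => ?_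
    filter_upwards [haX (X x), haY (Y x)] with y hy hy'
    filter_upwards [haX (X x), haY (Y x), haX (X y), haY (Y y)] with z hz hz' hw hw'
    refine tendsto_nhds_of_eventually_eq ?_
    filter_upwards [eventually_cellAdj_eq hy hy', eventually_cellAdj_eq hz hz',
      eventually_cellAdj_eq hw hw'] with m h1 h2 h3
    rw [h1, h2, h3]
  have hsimp := fun m => weights_mem_stdSimplex (P := P) (hc m)
  have hsq : concProb P X Y ^ 2 ≤ concTripleProb P X Y :=
    le_of_tendsto_of_tendsto' (hpair.pow 2) htriple fun m =>
      sq_pairMass_le_tripleMass (isReflGraph_cellAdj m) (hsimp m)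
  -- At an endpoint the discretised densities may fall outside the interval, so the bound there
  -- comes from the limit of p² ≤ t.
  rcases hp.1.eq_or_lt with h1 | h1
  · rw [← h1, cubeMin_left, h1]
    exact hsq
  rcases hp.2.eq_or_lt with h2 | h2
  · rw [h2, cubeMin_right hn', ← h2]
    exact hsq
  have hcF : Continuous (cubeMin n) := by unfold cubeMin; fun_prop
  refine le_of_tendsto_of_tendsto ((hcF.tendsto _).comp hpair) htriple ?_
  filter_upwards [hpair.eventually_mem (Ioo_mem_nhds h1 h2)] with m hm
  exact cubeMin_le_tripleMass (isReflGraph_cellAdj m) (hsimp m) hn ⟨hm.1.le, hm.2.le⟩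

end Coefficients

/-! ### Φ in terms of `cubeMin`. -/

lemma phiAux_eq {n : ℕ} (hn : 2 ≤ n) {x : ℝ} (hx : (2 - (n : ℝ)) / n ≤ x) :
    PhiAux n x = 2 * cubeMin n ((1 + x) / 2) - 1 := by
  have hn' : (2 : ℝ) ≤ n := by exact_mod_cast hn
  have hn0 : (0 : ℝ) < n := by linarith
  have hn1 : (0 : ℝ) < (n : ℝ) - 1 := by linarith
  unfold PhiAux cubeMin
  set N : ℝ := (n : ℝ)
  have hA : 0 ≤ N - 2 + N * x := by
    rw [div_le_iff₀ hn0] at hx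
    linarith
  set A := N - 2 + N * x with hAdef
  have h1 : A ^ (3 / 2 : ℝ) = √A ^ 3 := by
    rw [Real.sqrt_eq_rpow, ← Real.rpow_natCast, ← Real.rpow_mul hA]
    norm_num
  have h2 : ((1 + x) / 2 - 1 / N) / (N * (N - 1)) = A / (2 * N ^ 2 * (N - 1)) := by
    rw [hAdef]; field_simp; ring
  have h3 : √(A / (2 * N ^ 2 * (N - 1))) = √A / (√2 * N * √(N - 1)) := by
    rw [Real.sqrt_div hA, Real.sqrt_mul (by positivity), Real.sqrt_mul (by positivity),
      Real.sqrt_sq hn0.le]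
  rw [h1, h2, h3]
  have s2 : √2 ^ 2 = (2 : ℝ) := Real.sq_sqrt (by norm_num)
  have s1 : √(N - 1) ^ 2 = N - 1 := Real.sq_sqrt hn1.le
  have p2 : 0 < √(2 : ℝ) := by positivity
  have p1 : 0 < √(N - 1) := Real.sqrt_pos.2 hn1
  have h4 : N * (N - 1) * (N - 2) * (√A / (√2 * N * √(N - 1))) ^ 3 =
      (N - 2) / (√2 * N ^ 2 * √(N - 1)) * √A ^ 3 / 2 := by
    have e : (√2 * N * √(N - 1)) ^ 3 = 2 * (N - 1) * N * (√2 * N ^ 2 * √(N - 1)) := by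
      calc (√2 * N * √(N - 1)) ^ 3 = √2 ^ 2 * √(N - 1) ^ 2 * N * (√2 * N ^ 2 * √(N - 1)) := by ring
        _ = _ := by rw [s2, s1]
    rw [div_pow, e]
    field_simp
  rw [h4]
  field_simp
  ring

lemma PhiPiece.mem_Icc {n : ℕ} {x : ℝ} (h : PhiPiece n x) :
    (1 + x) / 2 ∈ Set.Icc (1 / (n : ℝ)) (1 / ((n : ℝ) - 1)) := by
  obtain ⟨hn, h1, h2⟩ := h
  have hn' : (2 : ℝ) ≤ n := by exact_mod_cast hn
  have hn0 : (0 : ℝ) < n := by linarith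
  have hn1 : (0 : ℝ) < (n : ℝ) - 1 := by linarith
  have e1 : (2 - (n : ℝ)) / n = 2 * (1 / n) - 1 := by field_simp
  have e2 : (2 - ((n : ℝ) - 1)) / ((n : ℝ) - 1) = 2 * (1 / ((n : ℝ) - 1)) - 1 := by field_simp
  rw [e1] at h1
  rw [e2] at h2
  constructor <;> linarith

lemma phi_cases (x : ℝ) :
    (∃ n : ℕ, 2 ≤ n ∧ (1 + x) / 2 ∈ Set.Icc (1 / (n : ℝ)) (1 / ((n : ℝ) - 1)) ∧
      Phi x = 2 * cubeMin n ((1 + x) / 2) - 1) ∨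
    ((¬ ∃ n : ℕ, PhiPiece n x) ∧ Phi x = -1) := by
  classical
  unfold Phi
  split_ifs with h
  · left
    have hs := Nat.find_spec h
    exact ⟨Nat.find h, hs.1, hs.mem_Icc, phiAux_eq hs.1 hs.2.1⟩
  · exact .inr ⟨h, rfl⟩

lemma exists_phiPiece {x : ℝ} (hx : -1 < x) (hx1 : x ≤ 1) : ∃ n : ℕ, PhiPiece n x := by
  have hp : 0 < (1 + x) / 2 := by linarith
  have hle : 1 ≤ 1 / ((1 + x) / 2) := by rw [le_div_iff₀ hp]; linarith
  have hm1 : 1 ≤ ⌊1 / ((1 + x) / 2)⌋₊ := Nat.le_floor (by exact_mod_cast hle)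
  have hm2 := Nat.floor_le (zero_le_one.trans hle)
  have hm3 := Nat.lt_floor_add_one (1 / ((1 + x) / 2))
  set m := ⌊1 / ((1 + x) / 2)⌋₊
  have hm0 : (0 : ℝ) < m := by exact_mod_cast hm1
  rw [le_div_iff₀ hp] at hm2
  rw [div_lt_iff₀ hp] at hm3
  -- The interval is the one with 1/(m + 1) ≤ p ≤ 1/m for p = (1 + x)/2, hence m = ⌊1/p⌋.
  refine ⟨m + 1, by omega, ?_, ?_⟩
  · push_cast
    rw [div_le_iff₀ (by positivity)]
    linarith
  · push_cast
    rw [add_sub_cancel_right, le_div_iff₀ hm0]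
    linarith

/-! ### The two bounds, and the reflection of Y. -/

section Bounds

lemma kendallTau_neg_right {Ω : Type*} [MeasurableSpace Ω] {P : Measure Ω} {X Y : Ω → ℝ} :
    kendallTau P X (fun ω => -Y ω) = -kendallTau P X Y := by
  unfold kendallTau
  have e : ∀ p : Ω × Ω, (X p.1 - X p.2) * (-Y p.1 - -Y p.2) =
      -((X p.1 - X p.2) * (Y p.1 - Y p.2)) := fun p => by ring
  simp only [e, gt_iff_lt, neg_pos, neg_lt_zero]
  ring

variable {Ω : Type*} [MeasurableSpace Ω] {P : Measure Ω} [IsProbabilityMeasure P] {X Y : Ω → ℝ}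

lemma phi_kendallTau_le_spearmanRho (hX : IsContinuousRV P X) (hY : IsContinuousRV P Y) :
    Phi (kendallTau P X Y) ≤ spearmanRho P X Y := by
  have haX := hX.isAtomless
  have haY := hY.isAtomless
  have ht := kendallTau_eq hX.1 hY.1 haX haY
  rw [spearmanRho_eq hX.1 hY.1 haX haY]
  rcases phi_cases (kendallTau P X Y) with ⟨n, hn, hmem, hphi⟩ | ⟨-, hphi⟩
  · have e : (1 + kendallTau P X Y) / 2 = concProb P X Y := by rw [ht]; ring
    rw [hphi, e]
    rw [e] at hmem
    linarith [cubeMin_le_concTripleProb hX.1 hY.1 haX haY hn hmem]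
  -- The default value −1 needs only ρ ≥ −1, so it is not necessary to know that τ lies in [−1, 1].
  · rw [hphi]
    linarith [concTripleProb_nonneg (P := P) (X := X) (Y := Y)]

lemma IsContinuousRV.neg (hX : IsContinuousRV P X) : IsContinuousRV P fun ω => -X ω := by
  refine IsAtomless.isContinuousRV hX.1.neg fun c => ?_
  filter_upwards [hX.isAtomless (-c)] with ω hω h
  exact hω (by rw [← h, neg_neg])

lemma spearmanRho_neg_right (X : Ω → ℝ) (hY : IsContinuousRV P Y) :
    spearmanRho P X (fun ω => -Y ω) = -spearmanRho P X Y := by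
  have hcdf : ∀ ω, cdf (P.map fun ω => -Y ω) (-Y ω) = 1 - cdf (P.map Y) (Y ω) := by
    intro ω
    rw [cdf_map_eq hY.1, cdf_map_eq (X := fun ω => -Y ω) hY.neg.1]
    have hi : Integrable (leInd Y ω) P :=
      (isBddMeas_pair (measurable_leInd hY.1) (leInd_zero_or_one Y)).swap_right.integrable_section
        ω ω
    have h1 : (1 : ℝ) = ∫ _, (1 : ℝ) ∂P := by simp
    conv_rhs => rw [h1]
    rw [← integral_sub (integrable_const _) hi]
    refine integral_congr_ae ?_
    filter_upwards [hY.isAtomless (Y ω)] with y hy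
    rw [← leInd_swap hy]
    simp [leInd]
  unfold spearmanRho pearsonCorr
  simp only [hcdf]
  have hm := memLp_cdf_comp (P := P) hY.1
  rw [covariance_const_sub_right (hm.integrable (by norm_num)),
    variance_const_sub hm.aestronglyMeasurable]
  ring

lemma spearmanRho_mem_Icc (hX : IsContinuousRV P X) (hY : IsContinuousRV P Y) :
    spearmanRho P X Y ∈ Set.Icc (Phi (kendallTau P X Y)) (-Phi (-kendallTau P X Y)) := by
  refine ⟨phi_kendallTau_le_spearmanRho hX hY, ?_⟩
  have h := phi_kendallTau_le_spearmanRho hX hY.neg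
  rw [kendallTau_neg_right, spearmanRho_neg_right X hY] at h
  linarith

end Bounds

/-! ### Extremal distributions. -/

section Sharpness

open unitInterval

/-- A point of a union of `n` blocks of weights `r i`, each a copy of the unit interval. -/
noncomputable def blockMeasure {n : ℕ} (r : Fin n → ℝ) : Measure (Fin n × I) :=
  (∑ i, ENNReal.ofReal (r i) • Measure.dirac i).prod volume

lemma isProbabilityMeasure_blockMeasure {n : ℕ} {r : Fin n → ℝ} (hr : r ∈ stdSimplex ℝ (Fin n)) :
    IsProbabilityMeasure (blockMeasure r) := by
  have : IsProbabilityMeasure (∑ i, ENNReal.ofReal (r i) • Measure.dirac i : Measure (Fin n)) := by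
    refine ⟨?_⟩
    simp only [Measure.coe_finsetSum, Finset.sum_apply, Measure.smul_apply, measure_univ,
      smul_eq_mul, mul_one]
    rw [← ENNReal.ofReal_sum_of_nonneg fun i _ => hr.1 i, hr.2, ENNReal.ofReal_one]
  unfold blockMeasure
  infer_instance

lemma weights_blockMeasure {n : ℕ} {r : Fin n → ℝ} (hr : r ∈ stdSimplex ℝ (Fin n)) :
    weights (blockMeasure r) Prod.fst = r := by
  ext i
  have : (Prod.fst ⁻¹' {i} : Set (Fin n × I)) = {i} ×ˢ Set.univ := by ext; simp
  rw [weights, this, blockMeasure, measureReal_def, Measure.prod_prod]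
  simp [Set.indicator_apply, hr.1 i]

lemma ae_blockMeasure {n : ℕ} (r : Fin n → ℝ) (g : Fin n → ℝ) :
    ∀ᵐ ω ∂(blockMeasure r), (ω.2 : ℝ) ≠ g ω.1 := by
  have hms : MeasurableSet {ω : Fin n × I | (ω.2 : ℝ) = g ω.1} :=
    measurableSet_eq_fun (by fun_prop) ((Measurable.of_discrete (f := g)).comp measurable_fst)
  rw [ae_iff]
  simp only [not_not]
  rw [blockMeasure, Measure.measure_prod_null hms]
  refine .of_forall fun i => ?_
  refine Set.Subsingleton.measure_zero (fun s hs t ht => Subtype.ext ?_) _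
  exact (show (s : ℝ) = g i from hs).trans (show (t : ℝ) = g i from ht).symm

lemma exists_of_stdSimplex {n : ℕ} {r : Fin n → ℝ} (hr : r ∈ stdSimplex ℝ (Fin n)) :
    ∃ (Ω : Type) (_ : MeasurableSpace Ω) (P : Measure Ω) (X Y : Ω → ℝ),
      IsProbabilityMeasure P ∧ IsContinuousRV P X ∧ IsContinuousRV P Y ∧
      kendallTau P X Y = 2 * ∑ i, r i ^ 2 - 1 ∧ spearmanRho P X Y = 2 * ∑ i, r i ^ 3 - 1 := by
  have hP := isProbabilityMeasure_blockMeasure hr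
  -- For points s, t in blocks i, j the concordance product is (s − t)² − 4(i − j)²: positive inside
  -- a block when s ≠ t, negative between blocks since |s − t| ≤ 1.
  let X : Fin n × I → ℝ := fun ω => ω.2 + 2 * (ω.1 : ℕ)
  let Y : Fin n × I → ℝ := fun ω => ω.2 - 2 * (ω.1 : ℕ)
  have hX : Measurable X := by fun_prop
  have hY : Measurable Y := by fun_prop
  have haX : IsAtomless (blockMeasure r) X := by
    intro c
    filter_upwards [ae_blockMeasure r fun i => c - 2 * (i : ℕ)] with ω hω h
    exact hω (by rw [← h]; simp [X])
  have haY : IsAtomless (blockMeasure r) Y := by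
    intro c
    filter_upwards [ae_blockMeasure r fun i => c + 2 * (i : ℕ)] with ω hω h
    exact hω (by rw [← h]; simp [Y])
  let a : Fin n → Fin n → ℝ := fun i j => if i = j then 1 else 0
  have hconc : ∀ {x y : Fin n × I}, (y.2 : ℝ) ≠ x.2 → concInd X Y x y = a x.1 y.1 := by
    rintro ⟨i, s⟩ ⟨j, t⟩ hne
    simp only [concInd, X, Y, a]
    by_cases hij : i = j
    · subst hij
      rw [if_pos rfl, if_pos]
      have : (s : ℝ) - t ≠ 0 := sub_ne_zero.2 hne.symm
      have h2 : 0 < ((s : ℝ) - t) ^ 2 := by positivity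
      linarith
    · rw [if_neg hij, if_neg]
      have h1 : (1 : ℝ) ≤ (((i : ℕ) : ℝ) - (j : ℕ)) ^ 2 := by
        have h3 : ((i : ℕ) : ℤ) - (j : ℕ) ≠ 0 := by
          rw [sub_ne_zero]
          exact fun h => hij (Fin.ext (by exact_mod_cast h))
        have h4 : (1 : ℤ) ≤ (((i : ℕ) : ℤ) - (j : ℕ)) ^ 2 :=
          Int.add_one_le_iff.2 (sq_pos_iff.2 h3)
        exact_mod_cast h4
      have h2 : ((s : ℝ) - t) ^ 2 ≤ 1 := by
        have := s.2.1
        have := s.2.2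
        have := t.2.1
        have := t.2.2
        rw [sq_le_one_iff_abs_le_one, abs_le]
        constructor <;> linarith
      nlinarith
  have hp : concProb (blockMeasure r) X Y = ∑ i, r i ^ 2 := by
    have h1 := tripleIntegral_pair_comp (P := blockMeasure r) (c := Prod.fst) measurable_fst a
    rw [weights_blockMeasure hr] at h1
    have h2 : concProb (blockMeasure r) X Y =
        tripleIntegral (blockMeasure r) (fun x y _ => a x.1 y.1) := by
      refine tripleIntegral_congr fun x => ?_
      filter_upwards [ae_blockMeasure r fun _ => x.2] with y hy
      exact .of_forall fun z => hconc hy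
    rw [h2, h1]
    simp [pairMass, wsum, wdeg, a, sq]
  have ht : concTripleProb (blockMeasure r) X Y = ∑ i, r i ^ 3 := by
    have h1 := tripleIntegral_majority_comp (P := blockMeasure r) (c := Prod.fst) measurable_fst a
    rw [weights_blockMeasure hr] at h1
    have h2 : concTripleProb (blockMeasure r) X Y = tripleIntegral (blockMeasure r)
        (fun x y z => majority (a x.1 y.1) (a y.1 z.1) (a x.1 z.1)) := by
      refine tripleIntegral_congr fun x => ?_
      filter_upwards [ae_blockMeasure r fun _ => x.2] with y hy
      filter_upwards [ae_blockMeasure r fun _ => x.2, ae_blockMeasure r fun _ => y.2] with z hz hw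
      rw [hconc hy, hconc hz, hconc hw]
    have h3 : ∀ i j k, majority (a i j) (a j k) (a i k) = a i j * a i k := by
      intro i j k
      simp only [a]
      by_cases hij : i = j
      · subst hij
        by_cases hik : i = k <;> norm_num [hik, majority]
      · by_cases hik : i = k
        · subst hik
          simp [hij, Ne.symm hij, majority]
        · simp [hij, hik, majority]
    rw [h2, h1]
    simp only [tripleMass, wsum, wcherry, h3]
    simp [a, pow_succ, mul_assoc]
  refine ⟨Fin n × I, inferInstance, blockMeasure r, X, Y, hP, haX.isContinuousRV hX,
    haY.isContinuousRV hY, ?_, ?_⟩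
  · rw [kendallTau_eq hX hY haX haY, hp]
  · rw [spearmanRho_eq hX hY haX haY, ht]

lemma exists_neg_one : ∃ (Ω : Type) (_ : MeasurableSpace Ω) (P : Measure Ω) (X Y : Ω → ℝ),
    IsProbabilityMeasure P ∧ IsContinuousRV P X ∧ IsContinuousRV P Y ∧
    kendallTau P X Y = -1 ∧ spearmanRho P X Y = -1 := by
  let X : I → ℝ := fun t => t
  let Y : I → ℝ := fun t => -t
  have haX : IsAtomless volume X := fun c => by
    rw [ae_iff]
    simp only [not_not]
    exact Set.Subsingleton.measure_zero
      (fun s hs t ht => Subtype.ext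
        ((show (s : ℝ) = c from hs).trans (show (t : ℝ) = c from ht).symm)) _
  have hX := haX.isContinuousRV (by fun_prop)
  have hY : IsContinuousRV volume Y := hX.neg
  have haY := hY.isAtomless
  have h0 : ∀ x y, concInd X Y x y = 0 := fun x y =>
    if_neg (by simp only [X, Y]; nlinarith [sq_nonneg ((x : ℝ) - y)])
  refine ⟨I, inferInstance, volume, X, Y, inferInstance, hX, hY, ?_, ?_⟩
  · rw [kendallTau_eq hX.1 hY.1 haX haY]
    simp [concProb, h0, tripleIntegral_const]
  · rw [spearmanRho_eq hX.1 hY.1 haX haY]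
    simp [concTripleProb, h0, majority, tripleIntegral_const]

lemma exists_eq_phi {x : ℝ} (hx : x ∈ Set.Icc (-1 : ℝ) 1) :
    ∃ (Ω : Type) (_ : MeasurableSpace Ω) (P : Measure Ω) (X Y : Ω → ℝ),
      IsProbabilityMeasure P ∧ IsContinuousRV P X ∧ IsContinuousRV P Y ∧
      kendallTau P X Y = x ∧ spearmanRho P X Y = Phi x := by
  rcases phi_cases x with ⟨n, hn, hmem, hphi⟩ | ⟨hno, hphi⟩
  · have hn' : (2 : ℝ) ≤ n := by exact_mod_cast hn
    obtain ⟨z, hz, hz', hpz⟩ := pair_param hn' hmem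
    rw [hpz, cubeMin_param hn' hz] at hphi
    obtain ⟨k, rfl⟩ : ∃ k, n = k + 1 := ⟨n - 1, by omega⟩
    have hk0 : (0 : ℝ) < (k : ℝ) + 1 := by positivity
    push_cast at hz' hpz hphi hn'
    rw [add_sub_cancel_right] at hz' hpz hphi
    have hk1 : (0 : ℝ) < k := by linarith
    -- The extremal clique sizes, with n = k + 1. The bound z ≤ 1/(n(n − 1)) is what keeps the small
    -- block nonnegative.
    let r : Fin (k + 1) → ℝ :=
      Fin.cons (1 / ((k : ℝ) + 1) - k * z) fun _ => 1 / ((k : ℝ) + 1) + z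
    have hr : r ∈ stdSimplex ℝ (Fin (k + 1)) := by
      refine ⟨fun i => ?_, ?_⟩
      · refine Fin.cases ?_ (fun j => ?_) i
        · simp only [r, Fin.cons_zero]
          rw [le_div_iff₀ (by positivity)] at hz'
          rw [sub_nonneg, le_div_iff₀ hk0]
          linarith
        · simp only [r, Fin.cons_succ]
          positivity
      · simp only [r, Fin.sum_univ_succ, Fin.cons_zero, Fin.cons_succ, Finset.sum_const,
          Finset.card_univ, Fintype.card_fin, nsmul_eq_mul]
        field_simp
        ring
    obtain ⟨Ω, hΩ, P, X, Y, hP, hX, hY, ht, hs⟩ := exists_of_stdSimplex hr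
    refine ⟨Ω, hΩ, P, X, Y, hP, hX, hY, ?_, ?_⟩
    · rw [ht]
      have : ∑ i, r i ^ 2 = (1 + x) / 2 := by
        rw [hpz]
        simp only [r, Fin.sum_univ_succ, Fin.cons_zero, Fin.cons_succ, Finset.sum_const,
          Finset.card_univ, Fintype.card_fin, nsmul_eq_mul]
        field_simp
        ring
      rw [this]
      ring
    · rw [hs, hphi]
      simp only [r, Fin.sum_univ_succ, Fin.cons_zero, Fin.cons_succ, Finset.sum_const,
        Finset.card_univ, Fintype.card_fin, nsmul_eq_mul]
      field_simp
      ring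
  · have hx1 : x = -1 := by
      rcases hx.1.eq_or_lt with h | h
      · exact h.symm
      · exact absurd (exists_phiPiece h hx.2) hno
    rw [hphi, hx1]
    exact exists_neg_one

end Sharpness

theorem corollary5p3 :
    -- the bounds
    (∀ {Ω : Type*} [MeasurableSpace Ω] (P : Measure Ω) [IsProbabilityMeasure P]
        (X Y : Ω → ℝ) (τ₀ : ℝ), IsContinuousRV P X → IsContinuousRV P Y →
        kendallTau P X Y = τ₀ →
        spearmanRho P X Y ∈ Set.Icc (Phi τ₀) (-Phi (-τ₀))) ∧
    -- the bounds are sharp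
    (∀ τ₀ ∈ Set.Icc (-1 : ℝ) 1,
      (∃ (Ω : Type) (_ : MeasurableSpace Ω) (P : Measure Ω) (X Y : Ω → ℝ),
        IsProbabilityMeasure P ∧ IsContinuousRV P X ∧ IsContinuousRV P Y ∧
        kendallTau P X Y = τ₀ ∧ spearmanRho P X Y = Phi τ₀) ∧
      (∃ (Ω : Type) (_ : MeasurableSpace Ω) (P : Measure Ω) (X Y : Ω → ℝ),
        IsProbabilityMeasure P ∧ IsContinuousRV P X ∧ IsContinuousRV P Y ∧
        kendallTau P X Y = τ₀ ∧ spearmanRho P X Y = -Phi (-τ₀))) := by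
  refine ⟨?_, fun τ₀ hτ => ⟨exists_eq_phi hτ, ?_⟩⟩
  · intro Ω _ P _ X Y τ₀ hX hY hτ
    rw [← hτ]
    exact spearmanRho_mem_Icc hX hY
  · obtain ⟨Ω, hΩ, P, X, Y, hP, hX, hY, ht, hs⟩ :=
      exists_eq_phi (x := -τ₀) ⟨by linarith [hτ.2], by linarith [hτ.1]⟩
    refine ⟨Ω, hΩ, P, X, fun ω => -Y ω, hP, hX, hY.neg, ?_, ?_⟩
    · rw [kendallTau_neg_right, ht, neg_neg]
    · rw [spearmanRho_neg_right X hY, hs]
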